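/- **Theorem (Fundamental theorem).** Strings are finite binary strings, $|p|$ is the length of $p$, natural numbers are identified with strings by $0\leftrightarrow\epsilon,\ 1\leftrightarrow 0,\ 2\leftrightarrow 1,\ 3\leftrightarrow 00,\ 4\leftrightarrow 01,\dots$, and $\langle x,y\rangle = 1^{|x|}0xy$. Let $U$ be a universal machine, that is, a partial recursive function on strings such that for each partial recursive $T$ there is an index $i$ with $U(\langle\langle i,p\rangle,y\rangle)=T(\langle p,y\rangle)$ for all $p,y$, and let $C(x|y)=\min\{|p| : U(\langle p,y\rangle)=x\}$ be the Kolmogorov complexity of $x$ given $y$. A Turing machine (deterministic, with finitely many tapes, finitely many states and a finite alphabet containing the two bits and a blank) is *reversible* if each configuration has at most one predecessor and no transition leads into the start state; no transition leaves the halting state. Write $R(s)=t$ if $R$, started in its start state with just $s$ on its input/output tape (the head on the first symbol) and all other tapes blank, reaches its halting state with just $t$ on the input/output tape (the head on the first symbol) and all other tapes blank. The irreversibility cost of computing $y$ from $x$ by a reversible Turing machine $R$, i.e. the number of bits irreversibly supplied plus the number of bits irreversibly erased, is $$E_R(x,y)=\min\{|p|+|q| : R(\langle x,p\rangle)=\langle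 y,q\rangle\}\qquad(\infty\text{ if there are no such }p,q).$$ Let $UR$ be a universal reversible Turing machine, that is, a reversible Turing machine such that for each reversible Turing machine $R$ there is a constant $c_R$ with $E_{UR}(x,y)\le E_R(x,y)+c_R$ for all $x,y$, and put $E(x,y)=E_{UR}(x,y)$. Then $E(x,y)=C(x|y)+C(y|x)$ up to an additive logarithmic term. Precisely, there are constants $c_1,c_2,c_3$ that depend only on $U$ and $UR$ such that for all strings $x,y$ $$\bigl|E(x,y)-(C(x|y)+C(y|x))\bigr|\le c_1\,\bigl\lfloor\log_2\bigl(C(x|y)+C(y|x)+2\bigr)\bigr\rfloor ,$$ $$E(x,y)\le C(y|x)+C(x|y)+2\bigl[C(C(y|x)|y)+C(C(x|y)|x)\bigr]+c_2 ,$$ $$E(x,y)\ge C(y|x)+C(x|y)-c_3 .$$ In particular $E(x,y)$ is finite. -/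

import Mathlib

/-! ### Binary strings, numbers and pairs -/

/-- The standard pairing of binary strings, `⟨x, y⟩ = 1^{|x|} 0 x y`. -/
def pair (x y : List Bool) : List Bool :=
  List.replicate x.length true ++ false :: (x ++ y)

theorem pair_takeWhile (x y : List Bool) :
    ((pair x y).takeWhile id).length = x.length := by
  simp only [pair]
  rw [List.takeWhile_append_of_pos (by simp)]
  simp

/-- Pairs can be decoded: the first component. -/
theorem pair_fst (x y : List Bool) :
    ((pair x y).drop (((pair x y).takeWhile id).length + 1)).take
      ((pair x y).takeWhile id).length = x := by
  rw [pair_takeWhile]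
  simp [pair, List.drop_append]

/-- Pairs can be decoded: the second component. -/
theorem pair_snd (x y : List Bool) :
    (pair x y).drop (2 * ((pair x y).takeWhile id).length + 1) = y := by
  rw [pair_takeWhile]
  have h : 2 * x.length + 1 - x.length = x.length + 1 := by omega
  simp [pair, List.drop_append, h]
  omega

theorem pair_injective {x y x' y' : List Bool} (h : pair x y = pair x' y') :
    x = x' ∧ y = y' := by
  constructor
  · rw [← pair_fst x y, h, pair_fst]
  · rw [← pair_snd x y, h, pair_snd]

/-- The identification of natural numbers with binary strings
`0 ↦ ε, 1 ↦ 0, 2 ↦ 1, 3 ↦ 00, 4 ↦ 01, …`: the binary expansion of `n + 1`, most significant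
digit first, without its leading digit. -/
def natToString (n : ℕ) : List Bool :=
  (Nat.bits (n + 1)).dropLast.reverse

/-! ### Kolmogorov complexity -/

/-- `U` is a universal machine: it is partial recursive, and each partial recursive `T` has an
index `i` with `U(⟨⟨i, p⟩, y⟩) = T(⟨p, y⟩)` for all `p`, `y`. -/
def IsUniversalMachine (U : List Bool →. List Bool) : Prop :=
  Partrec U ∧ ∀ T : List Bool →. List Bool, Partrec T →
    ∃ i : List Bool, ∀ p y : List Bool, U (pair (pair i p) y) = T (pair p y)

/-- The Kolmogorov complexity `C(x | y)` with respect to `U`: the least length of a program `p`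
with `U(⟨p, y⟩) = x`. -/
noncomputable def condC (U : List Bool →. List Bool) (x y : List Bool) : ℕ :=
  sInf {n : ℕ | ∃ p : List Bool, p.length = n ∧ x ∈ U (pair p y)}

/-- For a universal machine the minimum in the definition of `C(x | y)` is attained. -/
theorem exists_program_length_eq_condC {U : List Bool →. List Bool} (hU : IsUniversalMachine U)
    (x y : List Bool) : ∃ p : List Bool, p.length = condC U x y ∧ x ∈ U (pair p y) := by
  have hT : Computable (fun s : List Bool =>
      (s.drop ((s.takeWhile id).length + 1)).take (s.takeWhile id).length) := by
    have h1 : Primrec (fun s : List Bool => (s.takeWhile id).length) :=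
      Primrec.list_length.comp (Primrec.list_takeWhile Primrec.id)
    exact (Primrec.list_take.comp h1
      (Primrec.list_drop.comp (Primrec.succ.comp h1) Primrec.id)).to_comp
  obtain ⟨i, hi⟩ := hU.2 _ hT.partrec
  have hne : {n : ℕ | ∃ p : List Bool, p.length = n ∧ x ∈ U (pair p y)}.Nonempty := by
    refine ⟨_, pair i x, rfl, ?_⟩
    rw [hi x y]
    simp only [PFun.coe_val, Part.mem_some_iff]
    exact (pair_fst x y).symm
  exact Nat.sInf_mem hne

/-! ### Turing machines -/

/-- A deterministic Turing machine with finitely many two-way infinite tapes, one of which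
is used for input and output. Depending on its state and on the scanned symbols it halts or enters
a state and, on each tape, either writes a symbol or moves the head by one square. The blank
symbol is `default : Γ`. The halting state has no outgoing transition. -/
structure TuringMachine where
  /-- the tapes -/
  K : Type
  /-- the tape symbols -/
  Γ : Type
  /-- the states -/
  Q : Type
  [finiteK : Finite K]
  [decidableEqK : DecidableEq K]
  [finiteΓ : Finite Γ]
  [inhabitedΓ : Inhabited Γ]
  [finiteQ : Finite Q]
  /-- the tape for input and output -/
  io : K
  /-- the symbols that stand for the two bits -/
  bit : Bool → Γ
  bit_injective : Function.Injective bit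
  bit_ne_blank : ∀ b, bit b ≠ default
  start : Q
  halt : Q
  /-- the transition function -/
  δ : Q → (K → Γ) → Option (Q × (K → Turing.TM0.Stmt Γ))
  halt_halts : ∀ s, δ halt s = none

namespace TuringMachine

attribute [instance] finiteK decidableEqK finiteΓ inhabitedΓ finiteQ

/-- A configuration: the state, and the content and head position of each tape. -/
@[ext]
structure Cfg (M : TuringMachine) where
  state : M.Q
  tape : M.K → Turing.Tape M.Γ

/-- The effect of an elementary action on a tape. -/
def act {Γ : Type} [Inhabited Γ] : Turing.TM0.Stmt Γ → Turing.Tape Γ → Turing.Tape Γ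
  | .move d, t => t.move d
  | .write a, t => t.write a

/-- One step of the computation (`none` if the machine has halted). -/
def step (M : TuringMachine) (c : M.Cfg) : Option M.Cfg :=
  (M.δ c.state fun k => (c.tape k).head).map fun r =>
    ⟨r.1, fun k => act (r.2 k) (c.tape k)⟩

/-- The configuration in state `q` in which the input/output tape contains just the string `s`,
with its first symbol scanned, and all other tapes are blank. -/
def stdCfg (M : TuringMachine) (q : M.Q) (s : List Bool) : M.Cfg :=
  ⟨q, fun k => if k = M.io then Turing.Tape.mk₁ (s.map M.bit) else default⟩

/-- `M(s) = t`: started on `s`, the machine reaches its halting state with just `t` in memory. -/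
def Computes (M : TuringMachine) (s t : List Bool) : Prop :=
  StateTransition.Reaches M.step (M.stdCfg M.start s) (M.stdCfg M.halt t)

/-- `M` is reversible: every configuration has at most one predecessor, and no transition leads
into the start state (the mirror image of: no transition leaves the halting state). -/
structure IsReversible (M : TuringMachine) : Prop where
  backward_deterministic : ∀ c c' d : M.Cfg, M.step c = some d → M.step c' = some d → c = c'
  start_not_entered : ∀ q s r, M.δ q s = some r → r.1 ≠ M.start

end TuringMachine

/-! ### Irreversibility cost -/

/-- The irreversibility cost `E_R(x, y) = min {|p| + |q| : R(⟨x, p⟩) = ⟨y, q⟩}`, which is `⊤` if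
there are no such `p` and `q`. -/
noncomputable def irrevCost (R : TuringMachine) (x y : List Bool) : ℕ∞ :=
  ⨅ (p : List Bool) (q : List Bool) (_ : R.Computes (pair x p) (pair y q)),
    ((p.length + q.length : ℕ) : ℕ∞)

/-- `E_Q` is a universal irreversibility cost function: `Q` is a reversible Turing machine, and
`E_Q ≤ E_R + c_R` for each reversible Turing machine `R`. -/
def IsUniversalReversible (Q : TuringMachine) : Prop :=
  Q.IsReversible ∧ ∀ R : TuringMachine, R.IsReversible →
    ∃ c : ℕ, ∀ x y : List Bool, irrevCost Q x y ≤ irrevCost R x y + c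

open Turing Relation

/-! ### Reversible programs on several tapes -/

/-! Lower bound. If a reversible machine takes `⟨x, p⟩` to `⟨y, q⟩`, then `x` and `p` determine `y`
by running it. By reversibility `y` and `q` determine `x`, since the run can be traced back to a
unique input (`Computes.unique_input`). Such a relation is recursively enumerable
(`rePred_computes`), so `p` and `q` are programs up to a constant, and `C(y|x) + C(x|y) ≤ |p| + |q|
+ O(1)` (`exists_condC_add_condC_le`).

Upper bound. Let `p` be a shortest program for `y` given `x`, and `q` one for `x` given `y`. The
exchange of `⟨x, p⟩` and `⟨y, q⟩` is not yet a function: `x` and `p` yield `y`, but a shortest `q`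
cannot be found effectively. Once `|q|` is known, it can: for each length one program is chosen
effectively (`exists_canonical_programs`). So `x` is also given a shortest program `v` for `|q|`,
and `y` a shortest program `u` for `|p|`; to recover `u` as well, the side of `x` carries the number
`|u|`, and symmetrically the side of `y` carries `|v|`. The resulting relation is symmetric,
functional and recursively enumerable, hence a partial recursive involution, and the additional data
cost `2(|u| + |v|) + O(1)` bits (`exists_irrevCost_le`).

It remains that a partial recursive involution is computed by a reversible Turing machine
(`exists_reversible_of_involution`). This is Bennett's method: simulate an ordinary machine while
recording its history, copy the output, and undo the simulation, so that `s` becomes the pair `s,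
t`. As `s` is in turn computed from `t`, the same procedure run backwards removes `s`. The machines
are assembled from reversible flow charts (`RevProg`), which are closed under inversion,
composition, conditionals and loops.

The logarithmic form follows because `C(n|z)` is at most `log n + O(1)`. -/

/-- An elementary operation on a family of tapes: move the head of one tape, or replace the vector
of scanned symbols `h` by the vector `h'`. -/
inductive TapeOp (K Γ : Type)
  | move (k : K) (d : Dir)
  | rewrite (h h' : K → Γ)

namespace TapeOp

variable {K Γ : Type}

/-- The scanned symbols that the operation requires. -/
def pre : TapeOp K Γ → Option (K → Γ)
  | move _ _ => none
  | rewrite h _ => some h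

/-- The scanned symbols that the operation leaves. -/
def post : TapeOp K Γ → Option (K → Γ)
  | move _ _ => none
  | rewrite _ h' => some h'

/-- The opposite direction. -/
def opp : Dir → Dir
  | .left => .right
  | .right => .left

/-- The inverse operation. -/
def symm : TapeOp K Γ → TapeOp K Γ
  | move k d => move k (opp d)
  | rewrite h h' => rewrite h' h

theorem symm_symm (o : TapeOp K Γ) : o.symm.symm = o := by
  rcases o with ⟨k, d⟩ | _
  · cases d <;> rfl
  · rfl

theorem symm_injective : Function.Injective (symm : TapeOp K Γ → TapeOp K Γ) :=
  Function.LeftInverse.injective symm_symm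

theorem pre_symm (o : TapeOp K Γ) : o.symm.pre = o.post := by cases o <;> rfl

theorem post_symm (o : TapeOp K Γ) : o.symm.post = o.pre := by cases o <;> rfl

variable [DecidableEq K] [Inhabited Γ]

/-- The relation between the tapes before and after the operation. -/
def Rel : TapeOp K Γ → (K → Tape Γ) → (K → Tape Γ) → Prop
  | move k d, X, Y => Y = Function.update X k ((X k).move d)
  | rewrite h h', X, Y => (∀ k, (X k).head = h k) ∧ Y = fun k => (X k).write (h' k)

theorem Rel.unique {o : TapeOp K Γ} {X Y Y' : K → Tape Γ} (h : o.Rel X Y) (h' : o.Rel X Y') :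
    Y = Y' := by
  cases o with
  | move k d => exact h.trans h'.symm
  | rewrite a b => exact h.2.trans h'.2.symm

theorem move_opp (d : Dir) (T : Tape Γ) : (T.move d).move (opp d) = T := by
  cases d <;> simp [opp]

theorem Rel.symm {o : TapeOp K Γ} {X Y : K → Tape Γ} (h : o.Rel X Y) : o.symm.Rel Y X := by
  cases o with
  | move k d =>
    obtain rfl : Y = _ := h
    simp [TapeOp.symm, Rel, move_opp]
  | rewrite a b =>
    obtain ⟨h, rfl⟩ := h
    refine ⟨fun k => rfl, funext fun k => ?_⟩
    show X k = ((X k).write (b k)).write (a k)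
    rw [← h k]
    rfl

theorem Rel.pre {o : TapeOp K Γ} {X Y : K → Tape Γ} (h : o.Rel X Y) :
    ∀ a ∈ o.pre, (fun k => (X k).head) = a := by
  cases o with
  | move k d => simp [TapeOp.pre]
  | rewrite a b =>
    simp only [TapeOp.pre, Option.mem_def, Option.some.injEq]
    rintro _ rfl
    exact funext h.1

end TapeOp

/-- A reversible program: a finite graph whose edges are labelled by tape operations, such that the
next edge and the previous edge are determined by the state and the scanned symbols. -/
structure RevProg (K Γ : Type) where
  /-- the states -/
  Q : Type
  [finiteQ : Finite Q]
  start : Q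
  halt : Q
  /-- the transitions -/
  rule : Q → TapeOp K Γ → Q → Prop
  -- If one of the operations is a move, the premise on scanned symbols is vacuous, so a move has to
  -- be the only edge out of its state. Only rewrites may branch. `codet` is the mirror image, so
  -- that reversing all edges gives a program again.
  det : ∀ {q o q₁ o' q₂}, rule q o q₁ → rule q o' q₂ →
    (∀ h ∈ o.pre, ∀ h' ∈ o'.pre, h = h') → o = o' ∧ q₁ = q₂
  codet : ∀ {q o q₁ o' q₂}, rule q₁ o q → rule q₂ o' q →
    (∀ h ∈ o.post, ∀ h' ∈ o'.post, h = h') → o = o' ∧ q₁ = q₂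
  not_rule_start : ∀ q o, ¬ rule q o start
  not_rule_halt : ∀ q o, ¬ rule halt o q

namespace RevProg

attribute [instance] finiteQ

variable {K Γ : Type} [DecidableEq K] [Inhabited Γ]

/-- One step of a reversible program. -/
def Step (P : RevProg K Γ) (c d : P.Q × (K → Tape Γ)) : Prop :=
  ∃ o, P.rule c.1 o d.1 ∧ o.Rel c.2 d.2

/-- The program, started with tapes `X`, halts with tapes `Y`. -/
def Runs (P : RevProg K Γ) (X Y : K → Tape Γ) : Prop :=
  ReflTransGen P.Step (P.start, X) (P.halt, Y)

theorem Step.unique {P : RevProg K Γ} {c d d' : P.Q × (K → Tape Γ)} (h : P.Step c d)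
    (h' : P.Step c d') : d = d' := by
  obtain ⟨o, ho, hr⟩ := h
  obtain ⟨o', ho', hr'⟩ := h'
  obtain ⟨rfl, e⟩ := P.det ho ho' fun a ha b hb => (hr.pre a ha).symm.trans (hr'.pre b hb)
  exact Prod.ext e (hr.unique hr')

/-- The program run backwards. -/
def inv (P : RevProg K Γ) : RevProg K Γ where
  Q := P.Q
  start := P.halt
  halt := P.start
  rule q o q' := P.rule q' o.symm q
  det h h' H := by
    obtain ⟨e, rfl⟩ := P.codet h h' (by simpa only [TapeOp.post_symm] using H)
    exact ⟨TapeOp.symm_injective e, rfl⟩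
  codet h h' H := by
    obtain ⟨e, rfl⟩ := P.det h h' (by simpa only [TapeOp.pre_symm] using H)
    exact ⟨TapeOp.symm_injective e, rfl⟩
  not_rule_start q o h := P.not_rule_halt _ _ h
  not_rule_halt q o h := P.not_rule_start _ _ h

theorem Step.inv {P : RevProg K Γ} {c d : P.Q × (K → Tape Γ)} (h : P.Step c d) :
    P.inv.Step d c := by
  obtain ⟨o, ho, hr⟩ := h
  refine ⟨o.symm, ?_, hr.symm⟩
  show P.rule _ o.symm.symm _
  rwa [TapeOp.symm_symm]

/-- Each step can be reversed separately. Uncomputation rests on this: whatever a program has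
produced from known tapes, its inverse removes. -/
theorem Runs.inv {P : RevProg K Γ} {X Y : K → Tape Γ} (h : P.Runs X Y) : P.inv.Runs Y X := by
  have : ∀ {c d : P.Q × (K → Tape Γ)}, ReflTransGen P.Step c d → ReflTransGen P.inv.Step d c := by
    intro c d h
    induction h with
    | refl => exact .refl
    | tail _ h ih => exact .head h.inv ih
  exact this h

theorem Step.counique {P : RevProg K Γ} {c c' d : P.Q × (K → Tape Γ)} (h : P.Step c d)
    (h' : P.Step c' d) : c = c' :=
  Step.unique (P := P.inv) h.inv h'.inv

/-! ### Basic reversible programs and control structures. -/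

/-- Move the head of tape `k`. -/
def moveHead (k : K) (d : Dir) : RevProg K Γ where
  Q := Bool
  start := false
  halt := true
  rule q o q' := q = false ∧ o = .move k d ∧ q' = true
  det := by rintro _ _ _ _ _ ⟨rfl, rfl, rfl⟩ ⟨-, rfl, rfl⟩ _; simp
  codet := by rintro _ _ _ _ _ ⟨rfl, rfl, rfl⟩ ⟨rfl, rfl, -⟩ _; simp
  not_rule_start := by simp
  not_rule_halt := by simp

theorem moveHead_runs (k : K) (d : Dir) (X : K → Tape Γ) :
    (moveHead k d).Runs X (Function.update X k ((X k).move d)) :=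
  .single ⟨_, ⟨rfl, rfl, rfl⟩, rfl⟩

/-- If tape `k` scans a blank, write there a symbol that depends on the scanned symbols. -/
def fill (k : K) (φ : (K → Γ) → Γ) : RevProg K Γ where
  Q := Bool
  start := false
  halt := true
  rule q o q' := q = false ∧ q' = true ∧
    ∃ h, h k = default ∧ o = .rewrite h (Function.update h k (φ h))
  det := by
    rintro _ _ _ _ _ ⟨rfl, rfl, h, hk, rfl⟩ ⟨-, rfl, h', hk', rfl⟩ H
    obtain rfl : h = h' := H _ rfl _ rfl
    simp
  codet := by
    rintro _ _ _ _ _ ⟨rfl, rfl, h, hk, rfl⟩ ⟨rfl, -, h', hk', rfl⟩ H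
    -- The operation loses nothing: off `k` the symbols are unchanged, and at `k` the old symbol was
    -- blank.
    have e : Function.update h k (φ h) = Function.update h' k (φ h') := H _ rfl _ rfl
    have : h = h' := by
      funext j
      by_cases hj : j = k
      · rw [hj, hk, hk']
      · simpa [hj] using congrFun e j
    subst this
    simp
  not_rule_start := by simp
  not_rule_halt := by simp

theorem fill_runs (k : K) (φ : (K → Γ) → Γ) (X : K → Tape Γ) (h : (X k).head = default) :
    (fill k φ).Runs X (Function.update X k ((X k).write (φ fun j => (X j).head))) := by
  refine .single ⟨_, ⟨rfl, rfl, fun j => (X j).head, h, rfl⟩, fun _ => rfl, funext fun j => ?_⟩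
  by_cases hj : j = k
  · subst hj; simp
  · simp [hj, Tape.write_self]

/-- `P`, then `P'`. -/
def seq (P P' : RevProg K Γ) : RevProg K Γ where
  Q := P.Q ⊕ P'.Q
  start := .inl P.start
  halt := .inr P'.halt
  rule
    | .inl q, o, .inl q' => P.rule q o q'
    | .inr q, o, .inr q' => P'.rule q o q'
    -- Programs are linked by edges that rewrite the scanned symbols by themselves, one for each
    -- vector of symbols.
    | .inl q, o, .inr q' => q = P.halt ∧ q' = P'.start ∧ ∃ h, o = .rewrite h h
    | .inr _, _, .inl _ => False
  det := by
    rintro (q | q) o (q₁ | q₁) o' (q₂ | q₂) h h' H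
    · obtain ⟨rfl, rfl⟩ := P.det h h' H; exact ⟨rfl, rfl⟩
    · obtain ⟨rfl, -⟩ := h'; exact (P.not_rule_halt _ _ h).elim
    · obtain ⟨rfl, -⟩ := h; exact (P.not_rule_halt _ _ h').elim
    · obtain ⟨rfl, rfl, a, rfl⟩ := h
      obtain ⟨-, rfl, b, rfl⟩ := h'
      obtain rfl : a = b := H _ rfl _ rfl
      exact ⟨rfl, rfl⟩
    · exact h.elim
    · exact h.elim
    · exact h'.elim
    · obtain ⟨rfl, rfl⟩ := P'.det h h' H; exact ⟨rfl, rfl⟩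
  codet := by
    rintro (q | q) o (q₁ | q₁) o' (q₂ | q₂) h h' H
    · obtain ⟨rfl, rfl⟩ := P.codet h h' H; exact ⟨rfl, rfl⟩
    · exact h'.elim
    · exact h.elim
    · exact h.elim
    · obtain ⟨rfl, rfl, a, rfl⟩ := h
      obtain ⟨rfl, -, b, rfl⟩ := h'
      obtain rfl : a = b := H _ rfl _ rfl
      exact ⟨rfl, rfl⟩
    · obtain ⟨-, rfl, -⟩ := h; exact (P'.not_rule_start _ _ h').elim
    · obtain ⟨-, rfl, -⟩ := h'; exact (P'.not_rule_start _ _ h).elim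
    · obtain ⟨rfl, rfl⟩ := P'.codet h h' H; exact ⟨rfl, rfl⟩
  not_rule_start := by
    rintro (q | q) o h
    · exact P.not_rule_start _ _ h
    · exact h
  not_rule_halt := by
    rintro (q | q) o h
    · exact h
    · exact P'.not_rule_halt _ _ h

theorem rewrite_self_rel (X : K → Tape Γ) :
    (TapeOp.rewrite (fun k => (X k).head) fun k => (X k).head).Rel X X :=
  ⟨fun _ => rfl, funext fun k => (Tape.write_self (X k)).symm⟩

/-- Transport of computations along a map of states. -/
theorem reaches_map {P P' : RevProg K Γ} (f : P.Q → P'.Q)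
    (hf : ∀ q o q', P.rule q o q' → P'.rule (f q) o (f q')) {q q' : P.Q} {X Y : K → Tape Γ}
    (h : ReflTransGen P.Step (q, X) (q', Y)) : ReflTransGen P'.Step (f q, X) (f q', Y) :=
  ReflTransGen.lift (p := P'.Step) (fun c : P.Q × (K → Tape Γ) => (f c.1, c.2))
    (fun _ _ ⟨o, ho, hr⟩ => ⟨o, hf _ _ _ ho, hr⟩) _ _ h

theorem Runs.seq {P P' : RevProg K Γ} {X Y Z : K → Tape Γ} (h : P.Runs X Y) (h' : P'.Runs Y Z) :
    (P.seq P').Runs X Z := by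
  refine (reaches_map (P' := P.seq P') .inl (fun _ _ _ h => h) h).trans (.head ?_
    (reaches_map (P' := P.seq P') .inr (fun _ _ _ h => h) h'))
  exact ⟨_, ⟨rfl, rfl, _, rfl⟩, rewrite_self_rel Y⟩

/-- `P` if the scanned symbols satisfy `C`. The program `P` must preserve `C`. -/
def guard (C : (K → Γ) → Prop) (P : RevProg K Γ) : RevProg K Γ where
  Q := P.Q ⊕ Bool
  start := .inr false
  halt := .inr true
  rule
    | .inl q, o, .inl q' => P.rule q o q'
    | .inr q, o, .inl q' => q = false ∧ q' = P.start ∧ ∃ h, C h ∧ o = .rewrite h h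
    -- Where the branches merge, `C` is tested again: it tells a backward run which branch was
    -- taken.
    | .inl q, o, .inr q' => q = P.halt ∧ q' = true ∧ ∃ h, C h ∧ o = .rewrite h h
    | .inr q, o, .inr q' => q = false ∧ q' = true ∧ ∃ h, ¬ C h ∧ o = .rewrite h h
  det := by
    rintro (q | q) o (q₁ | q₁) o' (q₂ | q₂) h h' H
    · obtain ⟨rfl, rfl⟩ := P.det h h' H; exact ⟨rfl, rfl⟩
    · obtain ⟨rfl, -⟩ := h'; exact (P.not_rule_halt _ _ h).elim
    · obtain ⟨rfl, -⟩ := h; exact (P.not_rule_halt _ _ h').elim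
    all_goals
      obtain ⟨rfl, rfl, a, ha, rfl⟩ := h
      obtain ⟨-, rfl, b, hb, rfl⟩ := h'
      obtain rfl : a = b := H _ rfl _ rfl
      first
        | exact ⟨rfl, rfl⟩
        | exact absurd ha hb
        | exact absurd hb ha
  codet := by
    rintro (q | q) o (q₁ | q₁) o' (q₂ | q₂) h h' H
    · obtain ⟨rfl, rfl⟩ := P.codet h h' H; exact ⟨rfl, rfl⟩
    · obtain ⟨-, rfl, -⟩ := h'; exact (P.not_rule_start _ _ h).elim
    · obtain ⟨-, rfl, -⟩ := h; exact (P.not_rule_start _ _ h').elim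
    all_goals
      obtain ⟨rfl, rfl, a, ha, rfl⟩ := h
      obtain ⟨rfl, -, b, hb, rfl⟩ := h'
      obtain rfl : a = b := H _ rfl _ rfl
      first
        | exact ⟨rfl, rfl⟩
        | exact absurd ha hb
        | exact absurd hb ha
  not_rule_start := by
    rintro (q | q) o ⟨-, h, -⟩ <;> cases h
  not_rule_halt := by
    rintro (q | q) o ⟨h, -⟩ <;> cases h

theorem guard_runs_of_not {C : (K → Γ) → Prop} (P : RevProg K Γ) {X : K → Tape Γ}
    (h : ¬ C fun k => (X k).head) : (guard C P).Runs X X :=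
  ReflTransGen.single (a := (Sum.inr false, X)) (b := (Sum.inr true, X))
    ⟨_, ⟨rfl, rfl, _, h, rfl⟩, rewrite_self_rel X⟩

theorem Runs.guard {C : (K → Γ) → Prop} {P : RevProg K Γ} {X Y : K → Tape Γ} (h : P.Runs X Y)
    (hX : C fun k => (X k).head) (hY : C fun k => (Y k).head) : (guard C P).Runs X Y := by
  refine .head (a := (Sum.inr false, X)) (b := (Sum.inl P.start, X)) ⟨_, ⟨rfl, rfl, _, hX, rfl⟩, rewrite_self_rel X⟩
    (.tail (reaches_map (P' := RevProg.guard C P) .inl (fun _ _ _ h => h) h) ?_)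
  exact ⟨_, ⟨rfl, rfl, _, hY, rfl⟩, rewrite_self_rel Y⟩

/-- Repeat `P` until the scanned symbols satisfy `B`. The condition `A` holds at the first entry
into the loop and not at the later ones. -/
def loop (A B : (K → Γ) → Prop) (P : RevProg K Γ) : RevProg K Γ where
  Q := P.Q ⊕ Bool
  start := .inr false
  halt := .inr true
  rule
    | .inl q, o, .inl q' =>
      -- `¬ B` separates repetition from exit, for determinism. `¬ A` separates repetition from
      -- first entry, for backward determinism.
      P.rule q o q' ∨ (q = P.halt ∧ q' = P.start ∧ ∃ h, (¬ A h ∧ ¬ B h) ∧ o = .rewrite h h)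
    | .inr q, o, .inl q' => q = false ∧ q' = P.start ∧ ∃ h, A h ∧ o = .rewrite h h
    | .inl q, o, .inr q' => q = P.halt ∧ q' = true ∧ ∃ h, B h ∧ o = .rewrite h h
    | .inr _, _, .inr _ => False
  det := by
    rintro (q | q) o (q₁ | q₁) o' (q₂ | q₂) h h' H
    · rcases h with h | ⟨rfl, rfl, a, ha, rfl⟩
      · rcases h' with h' | ⟨rfl, -⟩
        · obtain ⟨rfl, rfl⟩ := P.det h h' H; exact ⟨rfl, rfl⟩
        · exact (P.not_rule_halt _ _ h).elim
      · rcases h' with h' | ⟨-, rfl, b, hb, rfl⟩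
        · exact (P.not_rule_halt _ _ h').elim
        · obtain rfl : a = b := H _ rfl _ rfl
          exact ⟨rfl, rfl⟩
    · obtain ⟨rfl, rfl, b, hb, rfl⟩ := h'
      rcases h with h | ⟨-, rfl, a, ha, rfl⟩
      · exact (P.not_rule_halt _ _ h).elim
      · obtain rfl : a = b := H _ rfl _ rfl
        exact absurd hb ha.2
    · obtain ⟨rfl, rfl, b, hb, rfl⟩ := h
      rcases h' with h | ⟨-, rfl, a, ha, rfl⟩
      · exact (P.not_rule_halt _ _ h).elim
      · obtain rfl : b = a := H _ rfl _ rfl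
        exact absurd hb ha.2
    · obtain ⟨rfl, rfl, a, ha, rfl⟩ := h
      obtain ⟨-, rfl, b, hb, rfl⟩ := h'
      obtain rfl : a = b := H _ rfl _ rfl
      exact ⟨rfl, rfl⟩
    · obtain ⟨rfl, rfl, a, ha, rfl⟩ := h
      obtain ⟨-, rfl, b, hb, rfl⟩ := h'
      obtain rfl : a = b := H _ rfl _ rfl
      exact ⟨rfl, rfl⟩
    · exact h'.elim
    · exact h.elim
    · exact h.elim
  codet := by
    rintro (q | q) o (q₁ | q₁) o' (q₂ | q₂) h h' H
    · rcases h with h | ⟨rfl, rfl, a, ha, rfl⟩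
      · rcases h' with h' | ⟨-, rfl, -⟩
        · obtain ⟨rfl, rfl⟩ := P.codet h h' H; exact ⟨rfl, rfl⟩
        · exact (P.not_rule_start _ _ h).elim
      · rcases h' with h' | ⟨rfl, -, b, hb, rfl⟩
        · exact (P.not_rule_start _ _ h').elim
        · obtain rfl : a = b := H _ rfl _ rfl
          exact ⟨rfl, rfl⟩
    · obtain ⟨rfl, rfl, b, hb, rfl⟩ := h'
      rcases h with h | ⟨rfl, -, a, ha, rfl⟩
      · exact (P.not_rule_start _ _ h).elim
      · obtain rfl : a = b := H _ rfl _ rfl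
        exact absurd hb ha.1
    · obtain ⟨rfl, rfl, b, hb, rfl⟩ := h
      rcases h' with h | ⟨rfl, -, a, ha, rfl⟩
      · exact (P.not_rule_start _ _ h).elim
      · obtain rfl : b = a := H _ rfl _ rfl
        exact absurd hb ha.1
    · obtain ⟨rfl, rfl, a, ha, rfl⟩ := h
      obtain ⟨rfl, -, b, hb, rfl⟩ := h'
      obtain rfl : a = b := H _ rfl _ rfl
      exact ⟨rfl, rfl⟩
    · obtain ⟨rfl, rfl, a, ha, rfl⟩ := h
      obtain ⟨rfl, -, b, hb, rfl⟩ := h'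
      obtain rfl : a = b := H _ rfl _ rfl
      exact ⟨rfl, rfl⟩
    · exact h'.elim
    · exact h.elim
    · exact h.elim
  not_rule_start := by
    rintro (q | q) o h
    · exact Bool.noConfusion h.2.1
    · exact h
  not_rule_halt := by
    rintro (q | q) o h
    · exact Bool.noConfusion h.1
    · exact h

/-- Repetitions of `P` from tapes `X`, until `B` holds for the first time, with tapes `Z`. -/
inductive Iterates (A B : (K → Γ) → Prop) (P : RevProg K Γ) :
    (K → Tape Γ) → (K → Tape Γ) → Prop
  | last {X Z} : P.Runs X Z → (B fun k => (Z k).head) → Iterates A B P X Z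
  | step {X Y Z} : P.Runs X Y → ¬ (A fun k => (Y k).head) → ¬ (B fun k => (Y k).head) →
      Iterates A B P Y Z → Iterates A B P X Z

theorem Iterates.loop {A B : (K → Γ) → Prop} {P : RevProg K Γ} {X Z : K → Tape Γ}
    (h : Iterates A B P X Z) (hA : A fun k => (X k).head) : (loop A B P).Runs X Z := by
  have : ReflTransGen (RevProg.loop A B P).Step (.inl P.start, X) (.inr true, Z) := by
    clear hA
    induction h with
    | last h hB =>
      refine .tail (reaches_map (P' := RevProg.loop A B P) .inl (fun _ _ _ h => .inl h) h) ?_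
      exact ⟨_, ⟨rfl, rfl, _, hB, rfl⟩, rewrite_self_rel _⟩
    | step h hA hB _ ih =>
      refine (reaches_map (P' := RevProg.loop A B P) .inl (fun _ _ _ h => .inl h) h).trans
        (.head ?_ ih)
      exact ⟨_, .inr ⟨rfl, rfl, _, ⟨hA, hB⟩, rfl⟩, rewrite_self_rel _⟩
  refine .head ?_ this
  exact ⟨_, ⟨rfl, rfl, _, hA, rfl⟩, rewrite_self_rel X⟩

/-! ### From reversible programs to Turing machines -/

section toTM

/-- What the Turing machine does on tape `k` to carry out an operation. -/
def opAction (h : K → Γ) (k : K) : TapeOp K Γ → TM0.Stmt Γ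
  | .move j d => if k = j then .move d else .write (h k)
  | .rewrite _ h' => .write (h' k)

theorem opAction_rel {o : TapeOp K Γ} {X : K → Tape Γ}
    (h : ∀ a ∈ o.pre, (fun k => (X k).head) = a) :
    o.Rel X fun k => TuringMachine.act (opAction (fun k => (X k).head) k o) (X k) := by
  cases o with
  | move j d =>
    refine funext fun k => ?_
    by_cases hk : k = j
    · subst hk; simp [opAction, TuringMachine.act]
    · simp [opAction, TuringMachine.act, hk, Tape.write_self]
  | rewrite a b => exact ⟨fun k => congrFun (h a rfl) k, rfl⟩

variable [Finite K] [Finite Γ]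

open Classical in
/-- The Turing machine that carries out a reversible program. -/
noncomputable def toTM (P : RevProg K Γ) (io : K) (bit : Bool → Γ)
    (bit_injective : Function.Injective bit) (bit_ne_blank : ∀ b, bit b ≠ default) :
    TuringMachine where
  K := K
  Γ := Γ
  Q := P.Q
  io := io
  bit := bit
  bit_injective := bit_injective
  bit_ne_blank := bit_ne_blank
  start := P.start
  halt := P.halt
  δ q h := if H : ∃ r : TapeOp K Γ × P.Q, P.rule q r.1 r.2 ∧ ∀ a ∈ r.1.pre, h = a then
    some (H.choose.2, fun k => opAction h k H.choose.1) else none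
  halt_halts _ := dif_neg fun ⟨_, h, _⟩ => P.not_rule_halt _ _ h

variable {P : RevProg K Γ} {io : K} {bit : Bool → Γ}
  {hi : Function.Injective bit} {hb : ∀ b, bit b ≠ default}

/-- The transition function selects an applicable edge by choice. By `det` there is at most one, so
the choice is immaterial and reversibility carries over from the program. -/
theorem step_toTM_iff {q q' : P.Q} {X Y : K → Tape Γ} :
    (P.toTM io bit hi hb).step ⟨q, X⟩ = some ⟨q', Y⟩ ↔ P.Step (q, X) (q', Y) := by
  have key : ∀ {q' Y}, (P.toTM io bit hi hb).step ⟨q, X⟩ = some ⟨q', Y⟩ →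
      P.Step (q, X) (q', Y) := by
    intro q' Y h
    simp only [TuringMachine.step, toTM] at h
    split_ifs at h with H
    · simp only [Option.map_some, Option.some.injEq] at h
      obtain ⟨rfl, rfl⟩ := h
      exact ⟨_, H.choose_spec.1, opAction_rel H.choose_spec.2⟩
    · simp at h
  refine ⟨key, fun h => ?_⟩
  have H : ∃ r : TapeOp K Γ × P.Q, P.rule q r.1 r.2 ∧ ∀ a ∈ r.1.pre, (fun k => (X k).head) = a :=
    let ⟨o, ho, hr⟩ := h; ⟨(o, q'), ho, hr.pre⟩
  obtain ⟨⟨q₁, Y₁⟩, h₁⟩ : ∃ d, (P.toTM io bit hi hb).step ⟨q, X⟩ = some d :=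
    ⟨_, by simp only [TuringMachine.step, toTM]; rw [dif_pos H]; rfl⟩
  obtain ⟨rfl, rfl⟩ := Prod.ext_iff.1 (h.unique (key h₁))
  exact h₁

theorem toTM_isReversible : (P.toTM io bit hi hb).IsReversible where
  backward_deterministic := by
    rintro ⟨q, X⟩ ⟨q', X'⟩ ⟨r, Y⟩ h h'
    obtain ⟨rfl, rfl⟩ := Prod.ext_iff.1 ((step_toTM_iff.1 h).counique (step_toTM_iff.1 h'))
    rfl
  start_not_entered := by
    intro q s r h e
    simp only [toTM] at h
    split_ifs at h with H
    · have := H.choose_spec.1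
      have e' : H.choose.2 = P.start := (congrArg Prod.fst (Option.some.inj h)).trans e
      rw [e'] at this
      exact P.not_rule_start _ _ this

theorem Runs.reaches_toTM {X Y : K → Tape Γ} (h : P.Runs X Y) :
    StateTransition.Reaches (P.toTM io bit hi hb).step ⟨P.start, X⟩ ⟨P.halt, Y⟩ :=
  ReflTransGen.lift (p := fun c d => d ∈ (P.toTM io bit hi hb).step c)
    (fun c : P.Q × (K → Tape Γ) => (⟨c.1, c.2⟩ : (P.toTM io bit hi hb).Cfg))
    (fun _ _ h => step_toTM_iff.2 h) _ _ h

end toTM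

end RevProg

/-! ### Partial recursive functions on one-tape machines -/

/-- The tape that encodes the stacks is determined by their contents. Hence a final configuration
with one nonempty stack has the same tape as an initial configuration, for which the encoding is
known from `TM2to1.trCfg_init`. This gives input and output the same format. -/
theorem addBottom_eq_trInit {K : Type} [DecidableEq K] {Γ : K → Type} (k : K) (l : List (Γ k))
    {L : ListBlank (∀ k, Option (Γ k))}
    (hL : ∀ j, L.map (proj j) =
      ListBlank.mk ((Function.update (fun _ => []) k l j : List (Γ j)).map some).reverse) :
    TM2to1.addBottom L = ListBlank.mk (TM2to1.trInit k l) := by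
  have h := TM2to1.trCfg_init (Λ := Unit) (σ := Unit) k l
  generalize hc : (TM1.init (TM2to1.trInit k l) :
    TM1.Cfg (TM2to1.Γ' K Γ) (TM2to1.Λ' K Γ Unit Unit) Unit) = c at h
  obtain ⟨L', hL'⟩ := h
  have e : L = L' := by
    refine ListBlank.ext fun i => funext fun j => ?_
    rw [← proj_map_nth, ← proj_map_nth, hL, hL']
  subst e
  have := congrArg (fun c => c.Tape.right₀) hc
  simp only [TM1.init, Tape.mk₁, Tape.mk₂, Tape.mk'_right₀] at this
  exact this.symm

/-- A finitely supported stack machine is simulated by a finite one-tape machine. -/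
theorem exists_machine_of_stack_machine {K : Type} [DecidableEq K] {Γ : K → Type}
    {Λ σ : Type} [Inhabited Λ] [Inhabited σ] [Fintype σ] (M : Λ → TM2.Stmt Γ Λ σ) (S : Finset Λ)
    (hS : TM2.Supports M S) (k : K) :
    ∃ (Q : Type) (_ : Inhabited Q) (_ : Finite Q) (N : TM0.Machine (TM2to1.Γ' K Γ) Q),
      ∀ (l l' : List (Γ k)) (v : σ), StateTransition.Reaches (TM2.step M) (TM2.init k l)
        ⟨none, v, Function.update (fun _ => []) k l'⟩ →
      ∃ q, TM0.Reaches N (TM0.init (TM2to1.trInit k l))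
        ⟨q, Tape.mk' ∅ (ListBlank.mk (TM2to1.trInit k l'))⟩ ∧ ∀ a, N q a = none := by
  classical
  have h₁ := TM2to1.tr_supports M hS
  have h₀ := TM1to0.tr_supports (TM2to1.tr M) h₁
  set N₀ := TM1to0.tr (TM2to1.tr M) with hN₀
  set S₀ := TM1to0.trStmts (TM2to1.tr M) (TM2to1.trSupp M S) with hS₀
  let _ : Inhabited S₀ := ⟨⟨default, h₀.1⟩⟩
  -- The translated machine may have infinitely many states, but it never leaves the finite set
  -- `S₀`. Sending all other states to the default one makes the machine finite without changing its
  -- runs.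
  let g₁ : PointedMap (TM1to0.Λ' (TM2to1.tr M)) S₀ :=
    ⟨fun q => if h : q ∈ S₀ then ⟨q, h⟩ else default, dif_pos h₀.1⟩
  have hg₁ : ∀ q ∈ (S₀ : Set _), ((g₁ q : S₀) : TM1to0.Λ' (TM2to1.tr M)) = q :=
    fun q hq => congrArg Subtype.val (dif_pos hq)
  let i : PointedMap (TM2to1.Γ' K Γ) (TM2to1.Γ' K Γ) := ⟨id, rfl⟩
  refine ⟨S₀, inferInstance, inferInstance, N₀.map i i g₁ Subtype.val, fun l l' v h => ?_⟩
  obtain ⟨c₁, t₁, r₁⟩ := StateTransition.tr_reaches (TM2to1.tr_respects M)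
    (TM2to1.trCfg_init k l) h
  obtain ⟨c₀, t₀, r₀⟩ := StateTransition.tr_reaches (TM1to0.tr_respects (TM2to1.tr M)) rfl r₁
  obtain ⟨c, t, r⟩ := StateTransition.tr_reaches
    (TM0.Machine.map_respects N₀ i i g₁ Subtype.val h₀ (fun _ => rfl) hg₁)
    (a₁ := TM0.init (TM2to1.trInit k l)) ⟨h₀.1, rfl⟩ r₀
  have hi : ∀ T : Tape (TM2to1.Γ' K Γ), T.map i = T := by
    intro T
    have hid : ∀ L : ListBlank (TM2to1.Γ' K Γ), L.map i = L := fun L =>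
      ListBlank.ext fun n => ListBlank.nth_map _ _ _
    rcases T with ⟨a, L, R⟩
    simp only [Tape.map, hid]
    rfl
  obtain ⟨L, hL⟩ := t₁
  subst t₀
  obtain ⟨t, rfl⟩ := t
  rw [addBottom_eq_trInit k l' hL] at r
  refine ⟨g₁ (TM1to0.trCfg (TM2to1.tr M)
    ⟨Option.map TM2to1.Λ'.normal none, v, Tape.mk' ∅ (TM2to1.addBottom L)⟩).q, ?_, fun a => ?_⟩
  · have e₁ : TM0.Cfg.map i g₁ (TM0.init (TM2to1.trInit k l)) = TM0.init (TM2to1.trInit k l) := by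
      rw [TM0.Cfg.map, TM0.init, TM0.init, hi, g₁.map_pt]
    rw [e₁, TM0.Cfg.map, hi] at r
    exact r
  · exact (congrArg (fun q => Option.map (Prod.map g₁.f (TM0.Stmt.map i))
      (TM1to0.tr (TM2to1.tr M) q a)) (hg₁ _ t)).trans rfl

/-- The number whose binary expansion is `1` followed by `s`. -/
def posOfString (s : List Bool) : PosNum :=
  s.foldl (fun n b => PosNum.bit b n) 1

theorem trPosNum_foldl (s : List Bool) (n : PosNum) :
    PartrecToTM2.trPosNum (s.foldl (fun n b => PosNum.bit b n) n) =
      (s.map fun b => cond b PartrecToTM2.Γ'.bit1 PartrecToTM2.Γ'.bit0).reverse ++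
        PartrecToTM2.trPosNum n := by
  induction s generalizing n with
  | nil => rfl
  | cons b s ih =>
    rw [List.foldl_cons, ih]
    cases b <;> simp [PosNum.bit, PartrecToTM2.trPosNum]

/-- The number whose binary expansion is `1` followed by `s`. -/
def numOfString (s : List Bool) : ℕ :=
  s.foldl (fun n b => n + n + b.toNat) 1

theorem coe_posOfString (s : List Bool) : (posOfString s : ℕ) = numOfString s := by
  have : ∀ n : PosNum, ((s.foldl (fun n b => PosNum.bit b n) n : PosNum) : ℕ) =
      s.foldl (fun n b => n + n + b.toNat) (n : ℕ) := by
    induction s with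
    | nil => intro n; rfl
    | cons b s ih =>
      intro n
      rw [List.foldl_cons, ih, List.foldl_cons]
      cases b <;> simp [PosNum.bit]
  exact this 1

theorem trNat_numOfString (s : List Bool) :
    PartrecToTM2.trNat (numOfString s) =
      ((true :: s).map fun b => cond b PartrecToTM2.Γ'.bit1 PartrecToTM2.Γ'.bit0).reverse := by
  rw [← coe_posOfString, PartrecToTM2.trNat, PosNum.of_to_nat]
  refine (trPosNum_foldl s 1).trans ?_
  simp only [List.map_cons, List.reverse_cons]
  rfl

theorem numOfString_injective : Function.Injective numOfString := by
  intro s t h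
  have := congrArg PartrecToTM2.trNat h
  rw [trNat_numOfString, trNat_numOfString, List.reverse_inj] at this
  have hinj : Function.Injective fun b => cond b PartrecToTM2.Γ'.bit1 PartrecToTM2.Γ'.bit0 := by
    intro a b; cases a <;> cases b <;> simp
  exact List.cons_injective ((List.map_injective_iff.2 hinj) this)

theorem primrec_numOfString : Primrec numOfString := by
  have h : Primrec₂ fun (_ : List Bool) (z : ℕ × Bool) => z.1 + z.1 + z.2.toNat :=
    Primrec.nat_add.comp (Primrec.nat_add.comp (Primrec.fst.comp Primrec.snd)
      (Primrec.fst.comp Primrec.snd))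
      ((Primrec.dom_finite Bool.toNat).comp (Primrec.snd.comp Primrec.snd))
  exact Primrec.list_foldl Primrec.id (Primrec.const 1) h

/-- Each recursively enumerable relation contains a partial recursive function with the same
domain. -/
theorem REPred.exists_selector {α β : Type} [Primcodable α] [Primcodable β] {p : α → β → Prop}
    (hp : REPred fun z : α × β => p z.1 z.2) :
    ∃ g : α →. β, Partrec g ∧ (∀ a b, b ∈ g a → p a b) ∧ ∀ a b, p a b → (g a).Dom := by
  obtain ⟨c, hc⟩ := Nat.Partrec.Code.exists_code.1 hp
  have key : ∀ a b, p a b ↔ ∃ k, (Nat.Partrec.Code.evaln k c (Encodable.encode (a, b))).isSome := by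
    intro a b
    have : p a b ↔ (Nat.Partrec.Code.eval c (Encodable.encode (a, b))).Dom := by
      rw [hc]
      simp [Part.assert]
    rw [this, Part.dom_iff_mem]
    simp only [Nat.Partrec.Code.evaln_complete, Option.isSome_iff_exists, Option.mem_def]
    exact exists_comm
  -- Dovetailing: `k` codes a time bound together with a candidate `b`, and the first candidate
  -- accepted within its time bound is returned.
  refine ⟨fun a => Nat.rfindOpt fun k => (Encodable.decode (α := β) k.unpair.2).bind fun b =>
    cond (Nat.Partrec.Code.evaln k.unpair.1 c (Encodable.encode (a, b))).isSome (some b) none,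
    ?_, ?_, ?_⟩
  · refine Partrec.rfindOpt (Primrec₂.to_comp (Primrec.option_bind (Primrec.decode.comp
      (Primrec.snd.comp (Primrec.unpair.comp Primrec.snd))) (Primrec.cond ?_
      (Primrec.option_some.comp Primrec.snd) (Primrec.const none))))
    exact Primrec.option_isSome.comp (Nat.Partrec.Code.primrec_evaln.comp (Primrec.pair
      (Primrec.pair (Primrec.fst.comp (Primrec.unpair.comp (Primrec.snd.comp Primrec.fst)))
      (Primrec.const c)) (Primrec.encode.comp (Primrec.pair
      (Primrec.fst.comp Primrec.fst) Primrec.snd))))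
  · intro a b h
    obtain ⟨k, hk⟩ := Nat.rfindOpt_spec h
    obtain ⟨b', -, hb'⟩ := Option.bind_eq_some_iff.1 hk
    rw [key]
    refine ⟨k.unpair.1, ?_⟩
    cases h' : (Nat.Partrec.Code.evaln k.unpair.1 c (Encodable.encode (a, b'))).isSome
    · rw [h'] at hb'; cases hb'
    · rw [h'] at hb'; cases hb'; exact h'
  · intro a b h
    obtain ⟨k, hk⟩ := (key a b).1 h
    refine Nat.rfindOpt_dom.2 ⟨Nat.pair k (Encodable.encode b), b, ?_⟩
    rw [Nat.unpair_pair, Encodable.encodek, Option.bind_some]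
    simp only [hk, cond_true, Option.mem_def]

/-- A partial recursive function on strings is computed by a one-tape machine, with the string `s`
represented by a marker, the symbol for `1`, and the symbols for the bits of `s`. -/
theorem exists_machine_of_partrec {f : List Bool →. List Bool} (hf : Partrec f) :
    ∃ (Γ Q : Type) (_ : Inhabited Γ) (_ : Finite Γ) (_ : Inhabited Q) (_ : Finite Q)
      (N : TM0.Machine Γ Q) (m : Γ) (e : Bool → Γ), Function.Injective e ∧ (∀ b, e b ≠ default) ∧
      (∀ b, e b ≠ m) ∧ m ≠ default ∧ ∀ s, ∀ t ∈ f s, ∃ q,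
        TM0.Reaches N (TM0.init (m :: (true :: s).map e))
          ⟨q, Tape.mk' ∅ (ListBlank.mk (m :: (true :: t).map e))⟩ ∧ ∀ a, N q a = none := by
  -- The available machines work on numbers, so `f` is conjugated by `numOfString`; `g` is its
  -- partial inverse, found by search.
  obtain ⟨g, hg, hg', hg''⟩ := REPred.exists_selector (p := fun (n : ℕ) s => numOfString s = n)
    (PrimrecPred.computablePred (Primrec.eq.comp (primrec_numOfString.comp Primrec.snd)
      Primrec.fst)).to_re
  have hg₁ : ∀ s, s ∈ g (numOfString s) := by
    intro s
    obtain ⟨s', hs'⟩ := Part.dom_iff_mem.1 (hg'' _ s rfl)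
    exact numOfString_injective (hg' _ _ hs') ▸ hs'
  have hF : Partrec fun n => ((g n).bind f).map numOfString :=
    (hg.bind (hf.comp Computable.snd).to₂).map
      (primrec_numOfString.to_comp.comp Computable.snd).to₂
  obtain ⟨c, hc⟩ := ToPartrec.Code.exists_code (Nat.Partrec'.part_iff₁.2 hF)
  let _ : Inhabited PartrecToTM2.Λ' := ⟨PartrecToTM2.trNormal c .halt⟩
  obtain ⟨Q, hQ, hQ', N, hN⟩ := exists_machine_of_stack_machine PartrecToTM2.tr
    (PartrecToTM2.codeSupp c .halt) (PartrecToTM2.tr_supports c .halt) PartrecToTM2.K'.main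
  have hK : Finite PartrecToTM2.K' := by
    refine Finite.of_injective (fun k : PartrecToTM2.K' => (k matches .main | .rev,
      k matches .main | .aux)) ?_
    rintro (_ | _ | _ | _) (_ | _ | _ | _) <;> simp
  let e : Bool → TM2to1.Γ' PartrecToTM2.K' fun _ => PartrecToTM2.Γ' := fun b =>
    (false, Function.update (fun _ => none) PartrecToTM2.K'.main
      (some (cond b PartrecToTM2.Γ'.bit1 PartrecToTM2.Γ'.bit0)))
  let m : TM2to1.Γ' PartrecToTM2.K' fun _ => PartrecToTM2.Γ' :=
    (true, Function.update (fun _ => none) PartrecToTM2.K'.main (some PartrecToTM2.Γ'.cons))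
  -- A stack lies on the tape with its bottom first, and numbers have their lowest digit on top. So
  -- the tape shows the end marker, the leading digit 1, and then `s` in its own order.
  have htr : ∀ s, TM2to1.trInit PartrecToTM2.K'.main (PartrecToTM2.trList [numOfString s]) =
      m :: (true :: s).map e := by
    intro s
    have h : (PartrecToTM2.trList [numOfString s]).reverse = PartrecToTM2.Γ'.cons ::
        (true :: s).map fun b => cond b PartrecToTM2.Γ'.bit1 PartrecToTM2.Γ'.bit0 := by
      rw [PartrecToTM2.trList, PartrecToTM2.trList, List.reverse_append, trNat_numOfString,
        List.reverse_reverse]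
      rfl
    unfold TM2to1.trInit
    rw [h]
    exact congrArg (List.cons m) (List.map_map ..)
  refine ⟨_, Q, inferInstance, ?_, hQ, hQ', N, m, e, ?_, ?_, ?_, ?_, ?_⟩
  · have : Finite (Bool × (PartrecToTM2.K' → Option PartrecToTM2.Γ')) := inferInstance
    exact this
  · intro a b h
    have := congrFun (congrArg Prod.snd h) PartrecToTM2.K'.main
    cases a <;> cases b <;> simp_all [e]
  · intro b h
    have := congrFun (congrArg Prod.snd h) PartrecToTM2.K'.main
    simp [e, default] at this
  · intro b h
    simpa [e, m] using congrArg Prod.fst h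
  · intro h
    simpa [m, default] using congrArg Prod.fst h
  · intro s t ht
    have hstk : ∀ n, PartrecToTM2.K'.elim (PartrecToTM2.trList [n]) [] [] [] =
        Function.update (fun _ => []) PartrecToTM2.K'.main (PartrecToTM2.trList [n]) := by
      intro n
      funext k
      cases k <;> rfl
    obtain ⟨q, hq, hq'⟩ := hN (PartrecToTM2.trList [numOfString s])
      (PartrecToTM2.trList [numOfString t]) none (by
        have h : PartrecToTM2.halt [numOfString t] ∈ StateTransition.eval
            (TM2.step PartrecToTM2.tr) (PartrecToTM2.init c [numOfString s]) := by
          rw [PartrecToTM2.tr_eval]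
          refine Part.mem_map _ ?_
          have := hc (List.Vector.cons (numOfString s) List.Vector.nil)
          simp only [List.Vector.cons] at this
          rw [this]
          exact Part.mem_map pure (Part.mem_map _ (Part.mem_bind (hg₁ s) ht))
        have h' := (StateTransition.mem_eval.1 h).1
        rw [PartrecToTM2.halt, PartrecToTM2.init, hstk, hstk] at h'
        exact h')
    rw [htr, htr] at hq
    exact ⟨q, hq, hq'⟩

/-! ### A reversible program for a partial recursive involution -/

theorem cons_default_empty {Γ : Type} [Inhabited Γ] :
    ListBlank.cons default (∅ : ListBlank Γ) = ∅ :=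
  ListBlank.cons_head_tail ∅

theorem default_eq_mk' {Γ : Type} [Inhabited Γ] : (default : Tape Γ) = Tape.mk' ∅ ∅ := rfl

theorem write_mk'_empty {Γ : Type} [Inhabited Γ] (a : Γ) (L : ListBlank Γ) :
    (Tape.mk' L ∅).write a = Tape.mk' L (ListBlank.cons a ∅) := by
  rw [Tape.write_mk']
  rfl

/-- The symbols of the reversible program: the symbols of the simulated machine, and records of a
state together with a symbol. -/
inductive TraceSym (Γ Q : Type)
  | sym (a : Γ)
  | trace (q : Option Q) (a : Γ)

namespace TraceSym

variable {Γ Q : Type}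

instance [Inhabited Γ] : Inhabited (TraceSym Γ Q) := ⟨sym default⟩

instance [Finite Γ] [Finite Q] : Finite (TraceSym Γ Q) :=
  Finite.of_injective (β := Γ ⊕ (Option Q × Γ))
    (fun | sym a => .inl a | trace q a => .inr (q, a))
    (by rintro (a | ⟨q, a⟩) (b | ⟨r, b⟩) <;> simp)

/-- The recorded symbol. -/
def symbol : TraceSym Γ Q → Γ
  | sym a => a
  | trace _ a => a

/-- The recorded state. -/
def state : TraceSym Γ Q → Option Q
  | sym _ => none
  | trace q _ => q

/-- The representation of a state, where `none` is represented by the blank. -/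
def ofState [Inhabited Γ] : Option Q → TraceSym Γ Q
  | none => default
  | some q => trace (some q) default

@[simp] theorem state_ofState [Inhabited Γ] (q : Option Q) :
    (ofState q : TraceSym Γ Q).state = q := by
  cases q <;> rfl

/-- `sym`, as a map that preserves the blank. -/
def symMap (Γ Q : Type) [Inhabited Γ] : PointedMap Γ (TraceSym Γ Q) := ⟨sym, rfl⟩

end TraceSym

namespace RevProg

open TraceSym

/-! ### Erasing a recomputable symbol, and copying a string. -/

section copy

variable {K Γ : Type} [DecidableEq K] [Inhabited Γ]

/-- A symbol can be erased reversibly when it can be recomputed from the symbols that remain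
scanned. -/
theorem fill_inv_runs (k : K) (φ : (K → Γ) → Γ) (X : K → Tape Γ)
    (h : (X k).head = φ fun j => (Function.update X k ((X k).write default) j).head) :
    (fill k φ).inv.Runs X (Function.update X k ((X k).write default)) := by
  have := (fill_runs k φ (Function.update X k ((X k).write default)) (by simp [Tape.write])).inv
  rw [← h] at this
  have e : Function.update (Function.update X k ((X k).write default)) k
      (((Function.update X k ((X k).write default)) k).write (X k).head) = X := by
    funext j
    by_cases hj : j = k
    · subst hj; simp [Tape.write]
    · simp [hj]
  rwa [e] at this

/-- Copy the string to the right of the head of tape `i`, which scans `m`, to the right of the head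
of tape `j`. -/
def copy (i j : K) (m : Γ) : RevProg K Γ :=
  -- The marker `m` and the blank delimit the string on tape `i`, so they serve as entry and exit
  -- tests; for the way back they change roles. `m` may itself be the blank.
  (loop (fun h => h i = m) (fun h => h i = default)
    (((moveHead i .right).seq (moveHead j .right)).seq (fill j fun h => h i))).seq
  (loop (fun h => h i = default) (fun h => h i = m)
    ((moveHead i .left).seq (moveHead j .left)))

variable {i j : K} {m : Γ} (hij : i ≠ j) {w : List Γ}

include hij

theorem update_update_update {β : Type} (X : K → β) (a b c : β) :
    Function.update (Function.update (Function.update X i a) j b) i c =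
      Function.update (Function.update X i c) j b := by
  rw [Function.update_comm hij, Function.update_idem, Function.update_comm hij]

theorem copy_forth_step (X : K → Tape Γ) (w : ListBlank Γ) (a d : Γ) (L L' : ListBlank Γ) :
    (((moveHead i .right).seq (moveHead j .right)).seq (fill j fun h => h i)).Runs
      (Function.update (Function.update X i (Tape.mk' L (ListBlank.cons a w)))
        j (Tape.mk' L' (ListBlank.cons d ∅)))
      (Function.update (Function.update X i (Tape.mk' (ListBlank.cons a L) w))
        j (Tape.mk' (ListBlank.cons d L') (ListBlank.cons w.head ∅))) := by
  have h := (moveHead_runs i .right (Function.update (Function.update X i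
    (Tape.mk' L (ListBlank.cons a w))) j (Tape.mk' L' (ListBlank.cons d ∅)))).seq
    (moveHead_runs j .right _)
  simp only [update_update_update hij, Function.update_idem, Function.update_self, ne_eq, hij,
    not_false_eq_true, Function.update_of_ne, Tape.move_right_mk', ListBlank.head_cons,
    ListBlank.tail_cons] at h
  have h' := h.seq (fill_runs j (fun h => h i) _ (by simp; rfl))
  simp only [Function.update_idem, Function.update_self, ne_eq, hij,
    not_false_eq_true, Function.update_of_ne, write_mk'_empty, Tape.mk'_head] at h'
  exact h'

theorem copy_forth (X : K → Tape Γ) (hw : ∀ a ∈ w, a ≠ default ∧ a ≠ m) (a d : Γ)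
    (L L' : ListBlank Γ) :
    Iterates (fun h => h i = m) (fun h => h i = default)
      (((moveHead i .right).seq (moveHead j .right)).seq (fill j fun h => h i))
      (Function.update (Function.update X i (Tape.mk' L (ListBlank.mk (a :: w))))
        j (Tape.mk' L' (ListBlank.cons d ∅)))
      (Function.update (Function.update X i (Tape.mk' (ListBlank.append (a :: w).reverse L) ∅))
        j (Tape.mk' (ListBlank.append (d :: w).reverse L') ∅)) := by
  induction w generalizing a d L L' with
  | nil =>
    refine .last ?_ ?_
    · have h := copy_forth_step hij X ∅ a d L L'
      rwa [show (∅ : ListBlank Γ).head = default from rfl, cons_default_empty] at h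
    · simp [hij]; rfl
  | cons b w ih =>
    have hb := hw b (by simp)
    have h := copy_forth_step hij X (ListBlank.mk (b :: w)) a d L L'
    refine .step h ?_ ?_ ?_
    · simpa [hij] using hb.2
    · simpa [hij] using hb.1
    · have := ih (fun a ha => hw a (by simp [ha])) b b (ListBlank.cons a L) (ListBlank.cons d L')
      rw [List.reverse_cons (a := a), List.reverse_cons (a := d), ListBlank.append_assoc,
        ListBlank.append_assoc]
      exact this

theorem copy_back (X : K → Tape Γ) (hw : ∀ a ∈ w, a ≠ default ∧ a ≠ m) (d : Γ)
    (L L' R R' : ListBlank Γ) :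
    Iterates (fun h => h i = default) (fun h => h i = m)
      ((moveHead i .left).seq (moveHead j .left))
      (Function.update (Function.update X i (Tape.mk' (ListBlank.append w (ListBlank.cons m L)) R))
        j (Tape.mk' (ListBlank.append w (ListBlank.cons d L')) R'))
      (Function.update (Function.update X i (Tape.mk' L (ListBlank.append (m :: w.reverse) R)))
        j (Tape.mk' L' (ListBlank.append (d :: w.reverse) R'))) := by
  have step : ∀ (a b : Γ) (L L' R R' : ListBlank Γ),
      ((moveHead i .left).seq (moveHead j .left)).Runs
        (Function.update (Function.update X i (Tape.mk' (ListBlank.cons a L) R))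
          j (Tape.mk' (ListBlank.cons b L') R'))
        (Function.update (Function.update X i (Tape.mk' L (ListBlank.cons a R)))
          j (Tape.mk' L' (ListBlank.cons b R'))) := by
    intro a b L L' R R'
    have h := (moveHead_runs i .left (Function.update (Function.update X i
      (Tape.mk' (ListBlank.cons a L) R)) j (Tape.mk' (ListBlank.cons b L') R'))).seq
      (moveHead_runs j .left _)
    simpa only [update_update_update hij, Function.update_idem, Function.update_self, ne_eq, hij,
      not_false_eq_true, Function.update_of_ne, Tape.move_left_mk', ListBlank.head_cons,
      ListBlank.tail_cons] using h
  induction w generalizing R R' with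
  | nil =>
    refine .last (step m d L L' R R') ?_
    simp [hij]
  | cons b w ih =>
    have hb := hw b (by simp)
    refine .step (step b b _ _ R R') ?_ ?_ ?_
    · simpa [hij] using hb.1
    · simpa [hij] using hb.2
    · have := ih (fun a ha => hw a (by simp [ha])) (ListBlank.cons b R) (ListBlank.cons b R')
      rw [List.reverse_cons, ← List.cons_append, ← List.cons_append, ListBlank.append_assoc,
        ListBlank.append_assoc]
      exact this

theorem copy_runs {X : K → Tape Γ} (hw : ∀ a ∈ w, a ≠ default ∧ a ≠ m) {d : Γ}
    {L L' : ListBlank Γ} (hi : X i = Tape.mk' L (ListBlank.mk (m :: w)))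
    (hj : X j = Tape.mk' L' (ListBlank.cons d ∅)) :
    (copy i j m).Runs X (Function.update X j (Tape.mk' L' (ListBlank.mk (d :: w)))) := by
  have hX : X = Function.update (Function.update X i (Tape.mk' L (ListBlank.mk (m :: w))))
      j (Tape.mk' L' (ListBlank.cons d ∅)) := by
    rw [← hi, ← hj, Function.update_eq_self, Function.update_eq_self]
  have hd : ∀ (l : List Γ), ListBlank.append l ∅ = ListBlank.mk l := fun l =>
    (ListBlank.append_mk l []).trans (by rw [List.append_nil])
  have h₁ := (copy_forth hij X hw m d L L').loop (by simp [hij])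
  have h₂ := (copy_back hij X (w := w.reverse) (fun a ha => hw a (by simpa using ha)) d L L' ∅ ∅).loop
    (by simp [hij]; rfl)
  rw [List.reverse_cons, List.reverse_cons, ListBlank.append_assoc, ListBlank.append_assoc,
    ← hX] at h₁
  have h := h₁.seq h₂
  rw [List.reverse_reverse, hd, hd, ← hi, Function.update_eq_self] at h
  exact h

end copy

/-! ### Simulating a one-tape machine reversibly by recording its history. -/

section simulation

/-- The five tapes: the tapes `a` and `b` (where `a` is the one with index `i`), and three
auxiliary tapes. -/
def tapes {α : Type} (i : Bool) (a b c d e : α) : Bool ⊕ Fin 3 → α :=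
  Sum.elim (fun k => if k = i then a else b) ![c, d, e]

section tapes

variable {α : Type} (i : Bool) (a b c d e x : α)

@[simp] theorem tapes_inl : tapes i a b c d e (.inl i) = a := if_pos rfl

@[simp] theorem tapes_inl_not : tapes i a b c d e (.inl !i) = b := by simp [tapes]

@[simp] theorem tapes_inr_zero : tapes i a b c d e (.inr 0) = c := rfl

@[simp] theorem tapes_inr_one : tapes i a b c d e (.inr 1) = d := rfl

@[simp] theorem tapes_inr_two : tapes i a b c d e (.inr 2) = e := rfl

@[simp] theorem update_tapes_inl :
    Function.update (tapes i a b c d e) (.inl i) x = tapes i x b c d e := by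
  funext k; rcases k with k | k
  · cases i <;> cases k <;> simp [tapes]
  · simp [tapes]

@[simp] theorem update_tapes_inl_not :
    Function.update (tapes i a b c d e) (.inl !i) x = tapes i a x c d e := by
  funext k; rcases k with k | k
  · cases i <;> cases k <;> simp [tapes]
  · simp [tapes]

@[simp] theorem update_tapes_inr_zero :
    Function.update (tapes i a b c d e) (.inr 0) x = tapes i a b x d e := by
  funext k; rcases k with k | k
  · simp [tapes]
  · fin_cases k <;> simp [tapes, Function.update]

@[simp] theorem update_tapes_inr_one :
    Function.update (tapes i a b c d e) (.inr 1) x = tapes i a b c x e := by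
  funext k; rcases k with k | k
  · simp [tapes]
  · fin_cases k <;> simp [tapes, Function.update]

@[simp] theorem update_tapes_inr_two :
    Function.update (tapes i a b c d e) (.inr 2) x = tapes i a b c d x := by
  funext k; rcases k with k | k
  · simp [tapes]
  · fin_cases k <;> simp [tapes, Function.update]

theorem tapes_not : tapes (!i) a b c d e = tapes i b a c d e := by
  funext k; rcases k with k | k
  · cases i <;> cases k <;> simp [tapes]
  · simp [tapes]

end tapes

variable {Γ Q : Type} [Inhabited Γ] [Inhabited Q] (N : TM0.Machine Γ Q)

/-- The transition function of `N` with an additional first state `none`. -/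
def next : Option Q → Γ → Option (Q × TM0.Stmt Γ)
  -- This idle transition lets the state tape start blank. It also gives the loop of `simulate`,
  -- whose body runs at least once, a step to carry out even if `N` halts immediately.
  | none, a => some (default, .write a)
  | some q, a => N q a

/-- The transition out of a recorded state. -/
def nextOf (x : TraceSym Γ Q) : Option (Q × TM0.Stmt Γ) := next N x.state x.symbol

/-- The state after the transition. -/
def newState (x : TraceSym Γ Q) : Option Q := (nextOf N x).map Prod.fst

/-- The symbol after the transition. -/
def newSymbol (x : TraceSym Γ Q) : Γ :=
  match nextOf N x with
  | some (_, .write b) => b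
  | _ => x.symbol

/-- The transition moves the head in the direction `d`. -/
def Moves (d : Dir) (x : TraceSym Γ Q) : Prop := ∃ q, nextOf N x = some (q, .move d)

/-- One step of the simulated machine: its tape is `inr 0`, its state is on the tape `inr 2`, and
the transitions are recorded on the tape `inr 1`. -/
def simStep : RevProg (Bool ⊕ Fin 3) (TraceSym Γ Q) :=
  -- Nothing is overwritten. The old state and symbol are recorded first, then erased by an inverse
  -- `fill` that recomputes them from the record, and only then are the new ones written into the
  -- blank squares. The final guards read only the record, which moving the tape `inr 0` leaves
  -- unchanged.
  (((((((moveHead (.inr 1) .right).seq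
    (fill (.inr 1) fun h => trace (h (.inr 2)).state (h (.inr 0)).symbol)).seq
    (fill (.inr 2) fun h => ofState (h (.inr 1)).state).inv).seq
    (fill (.inr 2) fun h => ofState (newState N (h (.inr 1))))).seq
    (fill (.inr 0) fun h => sym (h (.inr 1)).symbol).inv).seq
    (fill (.inr 0) fun h => sym (newSymbol N (h (.inr 1))))).seq
    (guard (fun h => Moves N .left (h (.inr 1))) (moveHead (.inr 0) .left))).seq
    (guard (fun h => Moves N .right (h (.inr 1))) (moveHead (.inr 0) .right))

variable {N}

theorem simStep_runs {i : Bool} {a b : Tape (TraceSym Γ Q)} {q : Option Q} {q' : Q}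
    {s : TM0.Stmt Γ} {T : Tape Γ} (h : next N q T.head = some (q', s))
    (L : ListBlank (TraceSym Γ Q)) (x : TraceSym Γ Q) :
    (simStep N).Runs
      (tapes i a b (T.map (symMap Γ Q)) (Tape.mk' L (ListBlank.cons x ∅))
        (Tape.mk' ∅ (ListBlank.cons (ofState q) ∅)))
      (tapes i a b ((TuringMachine.act s T).map (symMap Γ Q))
        (Tape.mk' (ListBlank.cons x L) (ListBlank.cons (trace q T.head) ∅))
        (Tape.mk' ∅ (ListBlank.cons (ofState (some q')) ∅))) := by
  have hn : nextOf N (trace q T.head) = some (q', s) := h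
  have hT : ∀ T : Tape Γ, (T.map (symMap Γ Q)).head = sym T.head := fun T => Tape.map_fst _ _
  have hw : ∀ (T : Tape Γ) (a : Γ), (T.map (symMap Γ Q)).write (sym a) =
    (T.write a).map (symMap Γ Q) := fun T a => (Tape.map_write (symMap Γ Q) a T).symm
  have hd : (default : TraceSym Γ Q) = sym default := rfl
  have hsym : ∀ a : Γ, (sym a : TraceSym Γ Q).symbol = a := fun _ => rfl
  have hsym' : ∀ q (a : Γ), (trace q a : TraceSym Γ Q).symbol = a := fun _ _ => rfl
  have hstate : ∀ q (a : Γ), (trace q a : TraceSym Γ Q).state = q := fun _ _ => rfl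
  have hnew : newState N (trace q T.head) = some q' := by simp [newState, hn]
  have h₁ := moveHead_runs (.inr 1) .right (tapes i a b (T.map (symMap Γ Q))
    (Tape.mk' L (ListBlank.cons x ∅)) (Tape.mk' ∅ (ListBlank.cons (ofState q) ∅)))
  simp only [tapes_inr_one, update_tapes_inr_one, Tape.move_right_mk', ListBlank.head_cons,
    ListBlank.tail_cons] at h₁
  have h₂ := h₁.seq (fill_runs (.inr 1)
    (fun h => trace (h (.inr 2)).state (h (.inr 0)).symbol) _ (by simp; rfl))
  simp only [tapes_inr_one, update_tapes_inr_one, tapes_inr_zero, tapes_inr_two, Tape.mk'_head,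
    ListBlank.head_cons, state_ofState, hT, hsym, write_mk'_empty] at h₂
  have h₃ := h₂.seq (fill_inv_runs (.inr 2) (fun h => ofState (h (.inr 1)).state) _
    (by simp [hstate]))
  simp only [tapes_inr_two, update_tapes_inr_two, Tape.write_mk', ListBlank.tail_cons,
    cons_default_empty] at h₃
  have h₄ := h₃.seq (fill_runs (.inr 2) (fun h => ofState (newState N (h (.inr 1)))) _
    (by simp; rfl))
  simp only [tapes_inr_two, update_tapes_inr_two, tapes_inr_one, write_mk'_empty, Tape.mk'_head,
    ListBlank.head_cons, hnew] at h₄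
  have h₅ := h₄.seq (fill_inv_runs (.inr 0) (fun h => sym (h (.inr 1)).symbol) _
    (by simp only [tapes_inr_zero, update_tapes_inr_zero, tapes_inr_one, hT, Tape.mk'_head,
      ListBlank.head_cons, hsym']))
  simp only [tapes_inr_zero, update_tapes_inr_zero, hd, hw] at h₅
  have h₆ := h₅.seq (fill_runs (.inr 0) (fun h => sym (newSymbol N (h (.inr 1)))) _
    (by simp only [tapes_inr_zero]; exact hT _))
  simp only [tapes_inr_zero, update_tapes_inr_zero, tapes_inr_one, Tape.mk'_head,
    ListBlank.head_cons, hw] at h₆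
  have hmem : ∀ d, Moves N d (trace q T.head) ↔ s = .move d := by
    intro d
    simp [Moves, hn]
  have htape : (T.write default).write (newSymbol N (trace q T.head)) =
      T.write (newSymbol N (trace q T.head)) := rfl
  rw [htape] at h₆
  cases s with
  | write c =>
    have hc : newSymbol N (trace q T.head) = c := by simp [newSymbol, hn]
    rw [hc] at h₆
    exact (h₆.seq (guard_runs_of_not _ (by simp [hmem]))).seq (guard_runs_of_not _ (by simp [hmem]))
  | move d =>
    have hc : newSymbol N (trace q T.head) = T.head := by simp [newSymbol, hn, hsym']
    rw [hc, Tape.write_self] at h₆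
    have hm := moveHead_runs (.inr 0) d (tapes i a b (T.map (symMap Γ Q))
      (Tape.mk' (ListBlank.cons x L) (ListBlank.cons (trace q T.head) ∅))
      (Tape.mk' ∅ (ListBlank.cons (ofState (some q')) ∅)))
    simp only [tapes_inr_zero, update_tapes_inr_zero, ← Tape.map_move] at hm
    cases d with
    | left =>
      exact (h₆.seq (hm.guard (by simp [hmem]) (by simp [hmem]))).seq
        (guard_runs_of_not _ (by simp [hmem]))
    | right =>
      exact (h₆.seq (guard_runs_of_not _ (by simp [hmem]))).seq
        (hm.guard (by simp [hmem]) (by simp [hmem]))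

variable (N) in
/-- Run the simulated machine until it halts. -/
def simulate : RevProg (Bool ⊕ Fin 3) (TraceSym Γ Q) :=
  -- The history tape scans a blank only before the first step, which identifies the entry into the
  -- loop.
  loop (fun h => h (.inr 1) = default)
    (fun h => next N (h (.inr 2)).state (h (.inr 0)).symbol = none) (simStep N)

/-- The history `d`, `e` is chosen before `a` and `b`. It is therefore still the right history after
the output has been stored on one of these tapes, and the simulation can be undone there. -/
theorem simulate_runs (i : Bool) {l : List Γ} {c : TM0.Cfg Γ Q}
    (h : TM0.Reaches N (TM0.init l) c) (hc : N c.q c.Tape.head = none) :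
    ∃ d e, ∀ a b : Tape (TraceSym Γ Q), (simulate N).Runs
      (tapes i a b ((Tape.mk₁ l).map (symMap Γ Q)) default default)
      (tapes i a b (c.Tape.map (symMap Γ Q)) d e) := by
  have hT : ∀ T : Tape Γ, (T.map (symMap Γ Q)).head = sym T.head := fun T => Tape.map_fst _ _
  have key : ∀ (c₁ : TM0.Cfg Γ Q) (L q' x),
      ReflTransGen (fun c d => d ∈ TM0.step N c) c₁ c → ∃ d e, ∀ a b X,
      (simStep N).Runs X (tapes i a b (c₁.Tape.map (symMap Γ Q))
        (Tape.mk' L (ListBlank.cons (trace q' x) ∅))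
        (Tape.mk' ∅ (ListBlank.cons (ofState (some c₁.q)) ∅))) →
      Iterates (fun h => h (.inr 1) = default)
        (fun h => next N (h (.inr 2)).state (h (.inr 0)).symbol = none) (simStep N) X
        (tapes i a b (c.Tape.map (symMap Γ Q)) d e) := by
    intro c₁ L q' x hr
    induction hr using ReflTransGen.head_induction_on generalizing L q' x with
    | refl =>
      refine ⟨_, _, fun a b X hX => .last hX ?_⟩
      simp only [tapes_inr_two, tapes_inr_zero, hT, Tape.mk'_head, ListBlank.head_cons,
        state_ofState]
      exact hc
    | @head c₁ c₂ h₁ _ ih =>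
      obtain ⟨⟨q₂, s⟩, h₂, h₃⟩ := Option.map_eq_some_iff.1 h₁
      have hn : next N (some c₁.q) c₁.Tape.head = some (q₂, s) := h₂
      obtain rfl : (⟨q₂, TuringMachine.act s c₁.Tape⟩ : TM0.Cfg Γ Q) = c₂ := by
        rw [← h₃]
        cases s <;> rfl
      obtain ⟨d, e, hde⟩ := ih (ListBlank.cons (trace q' x) L) (some c₁.q) c₁.Tape.head
      refine ⟨d, e, fun a b X hX => .step hX ?_ ?_
        (hde a b _ (simStep_runs (i := i) (a := a) (b := b) hn L (trace q' x)))⟩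
      · simp only [tapes_inr_one, Tape.mk'_head, ListBlank.head_cons]
        exact fun h => nomatch h
      · simp only [tapes_inr_two, tapes_inr_zero, hT, Tape.mk'_head, ListBlank.head_cons,
          state_ofState]
        intro h
        exact Option.some_ne_none _ (hn.symm.trans h)
  obtain ⟨d, e, hde⟩ := key (TM0.init l) (ListBlank.cons default ∅) none (Tape.mk₁ l).head h
  refine ⟨d, e, fun a b => ?_⟩
  have h₀ := simStep_runs (N := N) (i := i) (a := a) (b := b) (q := none) (T := Tape.mk₁ l)
    (q' := default) (s := .write (Tape.mk₁ l).head) rfl ∅ default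
  simp only [TuringMachine.act, Tape.write_self] at h₀
  have h₁ := hde a b _ h₀
  rw [cons_default_empty, ofState, cons_default_empty] at h₁
  exact h₁.loop (by simp; rfl)

theorem _root_.Turing.Tape.move_left_mk₁ {Γ : Type} [Inhabited Γ] (w : List Γ) :
    (Tape.mk₁ w).move .left = Tape.mk' ∅ (ListBlank.mk (default :: w)) :=
  Tape.move_left_mk' _ _

/-! ### Bennett's method: compute, store the output, uncompute. -/

variable (Q) in
/-- Copy the string on the tape `inl i`, preceded by a marker and a symbol, to the tape of the
simulated machine. -/
def load (i : Bool) (m c : Γ) : RevProg (Bool ⊕ Fin 3) (TraceSym Γ Q) :=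
  (((((moveHead (.inl i) .left).seq (fill (.inr 0) fun _ => sym m)).seq
    (moveHead (.inr 0) .right)).seq (fill (.inr 0) fun _ => sym c)).seq
    (copy (.inl i) (.inr 0) default)).seq (moveHead (.inr 0) .left)

variable (Q) in
/-- Copy the output of the simulated machine, without its first symbol, to the tape `inl !i`. -/
def store (i : Bool) (m c : Γ) : RevProg (Bool ⊕ Fin 3) (TraceSym Γ Q) :=
  -- The copy includes the leading symbol `c`. Being a known constant, it can be erased reversibly.
  (((copy (.inr 0) (.inl !i) (sym m)).seq (moveHead (.inl !i) .right)).seq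
    (fill (.inl !i) fun _ => sym c).inv).seq (moveHead (.inl !i) .right)

variable (Γ Q) in
/-- Copy the string on the tape `inl i` to the tape `inl !i`. -/
def duplicate (i : Bool) : RevProg (Bool ⊕ Fin 3) (TraceSym Γ Q) :=
  (((moveHead (.inl i) .left).seq (copy (.inl i) (.inl !i) default)).seq
    (moveHead (.inl i) .right)).seq (moveHead (.inl !i) .right)

variable (N) in
/-- Compute the output of `N` on the string on the tape `inl i`, put it on the tape `inl !i`, and
undo the computation. -/
def compute (i : Bool) (m c : Γ) : RevProg (Bool ⊕ Fin 3) (TraceSym Γ Q) :=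
  ((((load Q i m c).seq (simulate N)).seq (store Q i m c)).seq (simulate N).inv).seq
    (load Q i m c).inv

theorem map_symMap_mk₁ {Γ Q : Type} [Inhabited Γ] (l : List Γ) :
    (Tape.mk₁ l).map (symMap Γ Q) = Tape.mk' ∅ (ListBlank.mk (l.map sym)) :=
  Tape.map_mk₁ _ _

theorem load_runs {Γ Q : Type} [Inhabited Γ] (i : Bool) {m c : Γ} (b d e : Tape (TraceSym Γ Q))
    {w : List Γ}
    (hw : ∀ a ∈ w, a ≠ default) :
    (load Q i m c).Runs
      (tapes i (Tape.mk₁ (w.map sym)) b default d e)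
      (tapes i ((Tape.mk₁ (w.map sym)).move .left) b ((Tape.mk₁ (m :: c :: w)).map (symMap Γ Q))
        d e) := by
  have h₁ := (moveHead_runs (.inl i) .left (tapes i (Tape.mk₁ (w.map sym)) b default d e)).seq
    (fill_runs (.inr 0) (fun _ => sym m) _ (by simp; rfl))
  simp only [tapes_inl, update_tapes_inl, tapes_inr_zero, update_tapes_inr_zero, default_eq_mk',
    write_mk'_empty] at h₁
  have h₂ := (h₁.seq (moveHead_runs (.inr 0) .right _)).seq
    (fill_runs (.inr 0) (fun _ => sym c) _ (by simp; rfl))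
  simp only [tapes_inr_zero, update_tapes_inr_zero, Tape.move_right_mk', ListBlank.head_cons,
    ListBlank.tail_cons, write_mk'_empty] at h₂
  have h₃ := h₂.seq (copy_runs (i := .inl i) (j := .inr 0) (by simp) (w := w.map sym) (m := default)
    (by
      intro x hx
      obtain ⟨a, ha, rfl⟩ := List.mem_map.1 hx
      have : (sym a : TraceSym Γ Q) ≠ default := fun h => hw a ha (TraceSym.sym.inj h)
      exact ⟨this, this⟩) ((tapes_inl ..).trans (Tape.move_left_mk₁ _)) (tapes_inr_zero ..))
  have h₄ := h₃.seq (moveHead_runs (.inr 0) .left _)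
  simp only [tapes_inr_zero, update_tapes_inr_zero, Tape.move_left_mk', ListBlank.head_cons,
    ListBlank.tail_cons] at h₄
  rw [map_symMap_mk₁]
  exact h₄

theorem store_runs {Γ Q : Type} [Inhabited Γ] (i : Bool) {m c : Γ} (a d e : Tape (TraceSym Γ Q))
    {w : List Γ}
    (hw : ∀ a ∈ w, a ≠ default ∧ a ≠ m) (hc : c ≠ default ∧ c ≠ m) :
    (store Q i m c).Runs
      (tapes i a default ((Tape.mk₁ (m :: c :: w)).map (symMap Γ Q)) d e)
      (tapes i a (Tape.mk₁ (w.map sym)) ((Tape.mk₁ (m :: c :: w)).map (symMap Γ Q)) d e) := by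
  rw [map_symMap_mk₁]
  have h₁ := copy_runs (i := .inr 0) (j := .inl !i) (by simp) (w := (c :: w).map sym) (m := sym m)
    (X := tapes i a default (Tape.mk' ∅ (ListBlank.mk ((m :: c :: w).map sym))) d e)
    (d := default) (L' := ∅) (by
      intro x hx
      obtain ⟨a, ha, rfl⟩ := List.mem_map.1 hx
      have : a ≠ default ∧ a ≠ m := by
        rcases List.mem_cons.1 ha with rfl | ha
        · exact hc
        · exact hw a ha
      exact ⟨fun h => this.1 (TraceSym.sym.inj h), fun h => this.2 (TraceSym.sym.inj h)⟩)
    (tapes_inr_zero ..) (by rw [cons_default_empty]; simp [default_eq_mk'])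
  have h₂ := h₁.seq (moveHead_runs (.inl !i) .right _)
  simp only [update_tapes_inl_not, tapes_inl_not, Tape.move_right_mk', ListBlank.head_mk,
    ListBlank.tail_mk, List.headI, List.tail, cons_default_empty] at h₂
  have h₃ := h₂.seq (fill_inv_runs (.inl !i) (fun _ => sym c) _ (by simp))
  have h₄ := h₃.seq (moveHead_runs (.inl !i) .right _)
  simp only [update_tapes_inl_not, tapes_inl_not, Tape.write_mk', Tape.move_right_mk',
    ListBlank.head_cons, ListBlank.tail_cons, cons_default_empty] at h₄
  exact h₄

theorem duplicate_runs {Γ Q : Type} [Inhabited Γ] (i : Bool) (c d e : Tape (TraceSym Γ Q))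
    {w : List (TraceSym Γ Q)}
    (hw : ∀ a ∈ w, a ≠ default) :
    (duplicate Γ Q i).Runs (tapes i (Tape.mk₁ w) default c d e)
      (tapes i (Tape.mk₁ w) (Tape.mk₁ w) c d e) := by
  have h₁ := (moveHead_runs (.inl i) .left (tapes i (Tape.mk₁ w) default c d e))
  rw [update_tapes_inl, tapes_inl] at h₁
  replace h₁ := h₁.seq (copy_runs (i := .inl i) (j := .inl !i) (by simp) (w := w) (m := default) (d := default)
      (L := ∅) (L' := ∅) (fun a ha => ⟨hw a ha, hw a ha⟩) ((tapes_inl ..).trans (Tape.move_left_mk₁ _))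
      (by rw [cons_default_empty]; simp [default_eq_mk']))
  have h₂ := (h₁.seq (moveHead_runs (.inl i) .right _)).seq (moveHead_runs (.inl !i) .right _)
  simp only [update_tapes_inl_not, tapes_inl_not, update_tapes_inl, tapes_inl,
    Tape.move_right_mk', Tape.move_left_right, ListBlank.head_mk, ListBlank.tail_mk, List.headI,
    List.tail, cons_default_empty] at h₂
  exact h₂

/-- Storing the output changes only the tape `inl !i`, on which neither the simulation nor the
loading depends. Both can then be inverted, which clears the auxiliary tapes. -/
theorem compute_runs (i : Bool) {m c : Γ} {w w' : List Γ} (hw : ∀ a ∈ w, a ≠ default)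
    (hw' : ∀ a ∈ w', a ≠ default ∧ a ≠ m) (hc : c ≠ default ∧ c ≠ m) {q : Q}
    (h : TM0.Reaches N (TM0.init (m :: c :: w)) ⟨q, Tape.mk₁ (m :: c :: w')⟩)
    (hq : ∀ a, N q a = none) :
    (compute N i m c).Runs
      (tapes i (Tape.mk₁ (w.map sym)) default default default default)
      (tapes i (Tape.mk₁ (w.map sym)) (Tape.mk₁ (w'.map sym)) default default default) := by
  obtain ⟨d, e, hde⟩ := simulate_runs i h (hq _)
  have h₁ := load_runs (Q := Q) (m := m) (c := c) i default default default hw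
  have h₂ := load_runs (Q := Q) (m := m) (c := c) i (Tape.mk₁ (w'.map sym)) default default hw
  exact (((h₁.seq (hde _ _)).seq (store_runs i _ d e hw' hc)).seq (hde _ _).inv).seq h₂.inv

/-- A partial recursive involution is computed by a reversible Turing machine. -/
theorem _root_.exists_reversible_of_involution {f : List Bool →. List Bool} (hf : Partrec f)
    (h : ∀ s, ∀ t ∈ f s, s ∈ f t) :
    ∃ M : TuringMachine, M.IsReversible ∧ ∀ s, ∀ t ∈ f s, M.Computes s t := by
  obtain ⟨Γ, Q, _, _, _, _, N, m, e, he, he₀, hem, hm, hN⟩ := exists_machine_of_partrec hf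
  have he' : ∀ s : List Bool, ∀ a ∈ s.map e, a ≠ default := by
    intro s a ha
    obtain ⟨b, -, rfl⟩ := List.mem_map.1 ha
    exact he₀ b
  have he'' : ∀ s : List Bool, ∀ a ∈ s.map e, a ≠ default ∧ a ≠ m := by
    intro s a ha
    obtain ⟨b, -, rfl⟩ := List.mem_map.1 ha
    exact ⟨he₀ b, hem b⟩
  have hc : ∀ i, ∀ s, ∀ t ∈ f s, (compute N i m (e true)).Runs
      (tapes i (Tape.mk₁ ((s.map e).map sym)) default default default default)
      (tapes i (Tape.mk₁ ((s.map e).map sym)) (Tape.mk₁ ((t.map e).map sym))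
        default default default) := by
    intro i s t ht
    obtain ⟨q, hq, hq'⟩ := hN s t ht
    exact compute_runs i (he' s) (he'' t) ⟨he₀ _, hem _⟩ hq hq'
  have hd : ∀ i, ∀ t : List Bool, (duplicate Γ Q i).Runs
      (tapes i (Tape.mk₁ ((t.map e).map sym)) default default default default)
      (tapes i (Tape.mk₁ ((t.map e).map sym)) (Tape.mk₁ ((t.map e).map sym))
        default default default) := by
    refine fun i t => duplicate_runs i _ _ _ fun a ha => ?_
    obtain ⟨b, hb, rfl⟩ := List.mem_map.1 ha
    exact fun h => he' t b hb (TraceSym.sym.inj h)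
  -- The contents of the tapes `inl true`, `inl false` pass through `(s, -)`, `(s, t)`, `(-, t)`,
  -- `(t, t)`, `(t, -)`. The second transition removes `s` as the output computed from `t`, which is
  -- where the involution property is needed.
  let P := (((compute N true m (e true)).seq (compute N false m (e true)).inv).seq
    (duplicate Γ Q false)).seq (duplicate Γ Q true).inv
  refine ⟨P.toTM (.inl true) (fun b => sym (e b)) (fun a b h => he (TraceSym.sym.inj h))
    (fun b h => he₀ b (TraceSym.sym.inj h)), toTM_isReversible, fun s t ht => ?_⟩
  have h₁ := hc true s t ht
  have h₂ := (hc false t s (h s t ht)).inv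
  have h₃ := hd false t
  have h₄ := (hd true t).inv
  rw [show false = !true from rfl, tapes_not, tapes_not] at h₂ h₃
  have hP : P.Runs _ _ := ((h₁.seq h₂).seq h₃).seq h₄
  have hstd : ∀ w : List Bool, (fun k => if k = .inl true then
      Tape.mk₁ (w.map fun b => sym (e b)) else default :
      Bool ⊕ Fin 3 → Tape (TraceSym Γ Q)) =
      tapes true (Tape.mk₁ ((w.map e).map sym)) default default default default := by
    intro w
    funext k
    rw [List.map_map]
    rcases k with (_ | _) | k
    · rfl
    · rfl
    · fin_cases k <;> rfl
  rw [← hstd, ← hstd] at hP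
  exact hP.reaches_toTM

end simulation

end RevProg

/-! ### Turing machines compute partial recursive functions -/

/-- The projection is the domain of a partial recursive selector. -/
theorem REPred.exists {α β : Type} [Primcodable α] [Primcodable β] {p : α → β → Prop}
    (hp : REPred fun z : α × β => p z.1 z.2) : REPred fun a => ∃ b, p a b := by
  obtain ⟨g, hg, h₁, h₂⟩ := hp.exists_selector
  refine hg.dom_re.of_eq fun a => ⟨fun h => ?_, fun ⟨b, hb⟩ => h₂ a b hb⟩
  exact ⟨_, h₁ a _ (Part.get_mem h)⟩

/-- A finite type, as a primitive recursively encoded type. -/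
@[reducible]
noncomputable def Primcodable.ofFinite (α : Type) [Finite α] : Primcodable α :=
  Primcodable.ofEquiv _ (Finite.equivFin α)

/-- Beyond both lists all symbols are blank. The bound on `i` makes equality up to trailing blanks
primitive recursive. -/
theorem ListBlank.mk_eq_mk_iff {Γ : Type} [Inhabited Γ] (l l' : List Γ) :
    ListBlank.mk l = ListBlank.mk l' ↔
      ∀ i < l.length + l'.length, l.getI i = l'.getI i := by
  constructor
  · intro h i _
    rw [← ListBlank.nth_mk, h, ListBlank.nth_mk]
  · refine fun h => ListBlank.ext fun i => ?_
    rw [ListBlank.nth_mk, ListBlank.nth_mk]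
    by_cases hi : i < l.length + l'.length
    · exact h i hi
    · rw [List.getI_eq_default _ (by omega), List.getI_eq_default _ (by omega)]

theorem primrec_mk_eq_mk {Γ : Type} [Inhabited Γ] [Primcodable Γ] :
    PrimrecRel fun l l' : List Γ => ListBlank.mk l = ListBlank.mk l' := by
  have h : PrimrecRel fun (i : ℕ) (z : List Γ × List Γ) => z.1.getI i = z.2.getI i :=
    Primrec.eq.comp (Primrec.list_getI.comp (Primrec.fst.comp Primrec.snd) Primrec.fst)
      (Primrec.list_getI.comp (Primrec.snd.comp Primrec.snd) Primrec.fst)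
  have h' : Primrec fun z : List Γ × List Γ => List.range (z.1.length + z.2.length) :=
    Primrec.list_range.comp (Primrec.nat_add.comp (Primrec.list_length.comp Primrec.fst)
      (Primrec.list_length.comp Primrec.snd))
  refine (h.forall_mem_list.comp h' .id).of_eq fun z => ?_
  simp only [List.mem_range]
  exact (ListBlank.mk_eq_mk_iff z.1 z.2).symm

theorem Tape.mk'_inj {Γ : Type} [Inhabited Γ] {L R L' R' : ListBlank Γ} :
    Tape.mk' L R = Tape.mk' L' R' ↔ L = L' ∧ R = R' := by
  refine ⟨fun h => ⟨?_, ?_⟩, fun ⟨h, h'⟩ => h ▸ h' ▸ rfl⟩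
  · simpa using congrArg Tape.left h
  · simpa using congrArg Tape.right₀ h

/-- Letting a halted computation stand still makes the step function total, so reachability becomes
an existential statement about iterates. -/
theorem reaches_iff_iterate {σ : Type} {f : σ → Option σ} {a b : σ} :
    StateTransition.Reaches f a b ↔ ∃ n, (fun c => (f c).getD c)^[n] a = b := by
  constructor
  · intro h
    induction h with
    | refl => exact ⟨0, rfl⟩
    | tail _ h ih =>
      obtain ⟨n, rfl⟩ := ih
      refine ⟨n + 1, ?_⟩
      rw [Function.iterate_succ_apply', Option.mem_def.1 h, Option.getD_some]
  · rintro ⟨n, rfl⟩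
    induction n with
    | zero => exact .refl
    | succ n ih =>
      rw [Function.iterate_succ_apply']
      cases h : f ((fun c => (f c).getD c)^[n] a) with
      | none => exact ih
      | some c => exact ih.tail h

namespace TuringMachine

variable (M : TuringMachine)

/-- A representation of configurations by lists. -/
def ofLists {n : ℕ} (e : M.K → Fin n) (c : M.Q × (Fin n → List M.Γ × List M.Γ)) : M.Cfg :=
  ⟨c.1, fun k => Tape.mk' (ListBlank.mk (c.2 (e k)).1) (ListBlank.mk (c.2 (e k)).2)⟩

/-- Whether an elementary action moves the head in the given direction. -/
def movesTo {Γ : Type} (d : Dir) : TM0.Stmt Γ → Bool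
  | .move d' => d = d'
  | .write _ => false

/-- The symbol that an elementary action writes. -/
def written {Γ : Type} [Inhabited Γ] : TM0.Stmt Γ → Γ
  | .move _ => default
  | .write a => a

/-- The effect of an elementary action on a tape that is represented by two lists. -/
def actLists {Γ : Type} [Inhabited Γ] (s : TM0.Stmt Γ) (z : List Γ × List Γ) : List Γ × List Γ :=
  cond (movesTo .left s) (z.1.tail, z.1.headI :: z.2)
    (cond (movesTo .right s) (z.2.headI :: z.1, z.2.tail)
      (z.1, written s :: z.2.tail))

theorem act_mk' {Γ : Type} [Inhabited Γ] (s : TM0.Stmt Γ) (z : List Γ × List Γ) :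
    act s (Tape.mk' (ListBlank.mk z.1) (ListBlank.mk z.2)) =
      Tape.mk' (ListBlank.mk (actLists s z).1) (ListBlank.mk (actLists s z).2) := by
  rcases s with (_ | _) | a
  · simp [act, actLists, movesTo, written]
  · simp [act, actLists, movesTo, written]
  · simp [act, actLists, movesTo, written, Tape.write_mk']

instance {Γ : Type} [Finite Γ] : Finite (TM0.Stmt Γ) :=
  Finite.of_injective (β := Bool ⊕ Γ)
    (fun | .move .left => .inl false | .move .right => .inl true | .write a => .inr a)
    (by rintro ((_ | _) | a) ((_ | _) | b) <;> simp)

/-- One step on configurations that are represented by lists. -/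
def stepLists {n : ℕ} (e : M.K ≃ Fin n) (c : M.Q × (Fin n → List M.Γ × List M.Γ)) :
    M.Q × (Fin n → List M.Γ × List M.Γ) :=
  match M.δ c.1 fun k => (c.2 (e k)).2.headI with
  | none => c
  | some r => (r.1, fun i => actLists (r.2 (e.symm i)) (c.2 i))

theorem ofLists_stepLists {n : ℕ} (e : M.K ≃ Fin n) (c : M.Q × (Fin n → List M.Γ × List M.Γ)) :
    M.ofLists e (M.stepLists e c) = (M.step (M.ofLists e c)).getD (M.ofLists e c) := by
  have h : (fun k => ((M.ofLists e c).tape k).head) = fun k => (c.2 (e k)).2.headI := by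
    funext k
    simp [ofLists]
  rw [step, h, stepLists]
  show _ = (Option.map _ (M.δ c.1 _)).getD _
  cases M.δ c.1 fun k => (c.2 (e k)).2.headI with
  | none => rfl
  | some r =>
    refine TuringMachine.Cfg.ext rfl (funext fun k => ?_)
    simp [ofLists, act_mk']

/-- The standard configuration, represented by lists. -/
def stdLists {n : ℕ} (e : M.K → Fin n) [DecidableEq (Fin n)] (q : M.Q) (s : List Bool) :
    M.Q × (Fin n → List M.Γ × List M.Γ) :=
  (q, fun i => ([], if i = e M.io then s.map M.bit else []))

theorem ofLists_stdLists {n : ℕ} (e : M.K ≃ Fin n) (q : M.Q) (s : List Bool) :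
    M.ofLists e (M.stdLists e q s) = M.stdCfg q s := by
  refine TuringMachine.Cfg.ext rfl (funext fun k => ?_)
  simp only [ofLists, stdLists, stdCfg, EmbeddingLike.apply_eq_iff_eq]
  split_ifs <;> rfl

/-- With tapes represented by pairs of lists, a step is a finite table followed by list operations.
Its iterates and the equality of configurations are then primitive recursive, and only the number of
steps has to be searched for. -/
theorem rePred_computes : REPred fun z : List Bool × List Bool => M.Computes z.1 z.2 := by
  obtain ⟨n, ⟨e⟩⟩ := Finite.exists_equiv_fin M.K
  let _ : Primcodable M.Q := Primcodable.ofFinite M.Q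
  let _ : Primcodable M.Γ := Primcodable.ofFinite M.Γ
  let _ : Primcodable (TM0.Stmt M.Γ) := Primcodable.ofFinite (TM0.Stmt M.Γ)
  have hact : Primrec₂ (actLists : TM0.Stmt M.Γ → _) := by
    refine Primrec.cond ((Primrec.dom_finite (movesTo .left)).comp Primrec.fst) ?_
      (Primrec.cond ((Primrec.dom_finite (movesTo .right)).comp Primrec.fst) ?_ ?_)
    · exact Primrec.pair (Primrec.list_tail.comp (Primrec.fst.comp Primrec.snd))
        (Primrec.list_cons.comp (Primrec.list_headI.comp (Primrec.fst.comp Primrec.snd))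
          (Primrec.snd.comp Primrec.snd))
    · exact Primrec.pair (Primrec.list_cons.comp (Primrec.list_headI.comp
        (Primrec.snd.comp Primrec.snd)) (Primrec.fst.comp Primrec.snd))
        (Primrec.list_tail.comp (Primrec.snd.comp Primrec.snd))
    · exact Primrec.pair (Primrec.fst.comp Primrec.snd) (Primrec.list_cons.comp
        ((Primrec.dom_finite written).comp Primrec.fst) (Primrec.list_tail.comp (Primrec.snd.comp Primrec.snd)))
  have hstep : Primrec (M.stepLists e) := by
    let δ' : M.Q × (Fin n → M.Γ) → Option (M.Q × (Fin n → TM0.Stmt M.Γ)) := fun z =>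
      (M.δ z.1 fun k => z.2 (e k)).map fun r => (r.1, fun i => r.2 (e.symm i))
    have h₁ : Primrec fun c : M.Q × (Fin n → List M.Γ × List M.Γ) =>
        δ' (c.1, fun i => (c.2 i).2.headI) := by
      refine (Primrec.dom_finite δ').comp (Primrec.pair Primrec.fst (Primrec.fin_curry.2 ?_))
      exact Primrec.list_headI.comp (Primrec.snd.comp (Primrec.fin_app.comp
        (Primrec.snd.comp Primrec.fst) Primrec.snd))
    refine (Primrec.option_casesOn h₁ Primrec.id
      (g := fun c r => (r.1, fun i => actLists (r.2 i) (c.2 i))) ?_).of_eq fun c => ?_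
    · refine Primrec.pair (Primrec.fst.comp Primrec.snd) (Primrec.fin_curry.2 ?_)
      exact hact.comp (Primrec.fin_app.comp (Primrec.snd.comp (Primrec.snd.comp Primrec.fst))
        Primrec.snd) (Primrec.fin_app.comp (Primrec.snd.comp (Primrec.fst.comp Primrec.fst))
        Primrec.snd)
    · simp only [δ', stepLists]
      cases M.δ c.1 fun k => (c.2 (e k)).2.headI <;> rfl
  have hstd : ∀ q, Primrec (M.stdLists e q) := by
    intro q
    refine Primrec.pair (Primrec.const q) (Primrec.fin_curry.2 (Primrec.pair (Primrec.const [])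
      (Primrec.ite (Primrec.eq.comp Primrec.snd (Primrec.const _)) ?_ (Primrec.const []))))
    exact Primrec.list_map Primrec.fst ((Primrec.dom_finite M.bit).comp Primrec.snd).to₂
  have heq : PrimrecRel fun c c' : M.Q × (Fin n → List M.Γ × List M.Γ) =>
      M.ofLists e c = M.ofLists e c' := by
    classical
    have h₁ : Primrec fun z : (M.Q × (Fin n → List M.Γ × List M.Γ)) ×
        (M.Q × (Fin n → List M.Γ × List M.Γ)) => fun i : Fin n =>
        decide (ListBlank.mk (z.1.2 i).1 = ListBlank.mk (z.2.2 i).1) &&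
          decide (ListBlank.mk (z.1.2 i).2 = ListBlank.mk (z.2.2 i).2) := by
      have ha : Primrec₂ fun (z : (M.Q × (Fin n → List M.Γ × List M.Γ)) ×
        (M.Q × (Fin n → List M.Γ × List M.Γ))) (i : Fin n) => z.1.2 i :=
        Primrec.fin_app.comp (Primrec.snd.comp (Primrec.fst.comp Primrec.fst)) Primrec.snd
      have hb : Primrec₂ fun (z : (M.Q × (Fin n → List M.Γ × List M.Γ)) ×
        (M.Q × (Fin n → List M.Γ × List M.Γ))) (i : Fin n) => z.2.2 i :=
        Primrec.fin_app.comp (Primrec.snd.comp (Primrec.snd.comp Primrec.fst)) Primrec.snd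
      refine Primrec.fin_curry.2 (Primrec.and.comp ?_ ?_)
      · exact (primrec_mk_eq_mk.comp (Primrec.fst.comp ha) (Primrec.fst.comp hb)).decide
      · exact (primrec_mk_eq_mk.comp (Primrec.snd.comp ha) (Primrec.snd.comp hb)).decide
    have h₂ : PrimrecPred fun z : (M.Q × (Fin n → List M.Γ × List M.Γ)) ×
        (M.Q × (Fin n → List M.Γ × List M.Γ)) => z.1.1 = z.2.1 :=
      Primrec.eq.comp (Primrec.fst.comp Primrec.fst) (Primrec.fst.comp Primrec.snd)
    have h₃ := h₂.and (Primrec.eq.comp ((Primrec.dom_finite fun b : Fin n → Bool =>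
      decide (∀ i, b i = true)).comp h₁) (Primrec.const true))
    refine h₃.of_eq fun z => ?_
    simp only [decide_eq_true_eq, Bool.and_eq_true]
    rw [TuringMachine.Cfg.ext_iff, funext_iff]
    simp only [ofLists, Tape.mk'_inj]
    exact and_congr_right fun _ => e.forall_congr_right.symm
  have hP : REPred fun z : (List Bool × List Bool) × ℕ =>
      M.ofLists e ((M.stepLists e)^[z.2] (M.stdLists e M.start z.1.1)) =
        M.ofLists e (M.stdLists e M.halt z.1.2) := by
    refine (PrimrecPred.computablePred (heq.comp ?_ ?_)).to_re
    · exact Primrec.nat_iterate Primrec.snd ((hstd _).comp (Primrec.fst.comp Primrec.fst))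
        (hstep.comp Primrec.snd).to₂
    · exact (hstd _).comp (Primrec.snd.comp Primrec.fst)
  refine (REPred.exists (p := fun (z : List Bool × List Bool) n =>
    M.ofLists e ((M.stepLists e)^[n] (M.stdLists e M.start z.1)) =
        M.ofLists e (M.stdLists e M.halt z.2)) hP).of_eq fun z => ?_
  rw [Computes, reaches_iff_iterate]
  refine exists_congr fun n => ?_
  have h : M.ofLists e ((M.stepLists e)^[n] (M.stdLists e M.start z.1)) =
      (fun c => (M.step c).getD c)^[n] (M.stdCfg M.start z.1) := by
    have h : Function.Semiconj (M.ofLists e) (M.stepLists e) fun c => (M.step c).getD c :=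
      M.ofLists_stepLists e
    rw [← M.ofLists_stdLists e]
    exact h.iterate_right n _
  rw [h, ofLists_stdLists]

variable {M}

theorem stdCfg_injective {q : M.Q} {s t : List Bool} (h : M.stdCfg q s = M.stdCfg q t) : s = t := by
  have h₁ : Tape.mk₁ (s.map M.bit) = Tape.mk₁ (t.map M.bit) := by
    simpa [stdCfg] using congrFun (congrArg Cfg.tape h) M.io
  have h₂ : ListBlank.mk (s.map M.bit) = ListBlank.mk (t.map M.bit) := (Tape.mk'_inj.1 h₁).2
  have key : ∀ {s t : List Bool},
      ListBlank.mk (s.map M.bit) = ListBlank.mk (t.map M.bit) → s = t := by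
    intro s
    induction s with
    | nil =>
      rintro (_ | ⟨b, t⟩) h
      · rfl
      · exact absurd (congrArg ListBlank.head h).symm (M.bit_ne_blank b)
    | cons a s ih =>
      rintro (_ | ⟨b, t⟩) h
      · exact absurd (congrArg ListBlank.head h) (M.bit_ne_blank a)
      · rw [M.bit_injective (congrArg ListBlank.head h), ih (congrArg ListBlank.tail h)]
  exact key h₂

theorem Computes.unique {s t t' : List Bool} (h : M.Computes s t) (h' : M.Computes s t') :
    t = t' := by
  have hh : ∀ t, M.step (M.stdCfg M.halt t) = none := fun t => by
    simp [step, stdCfg, M.halt_halts]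
  exact stdCfg_injective (Part.mem_unique (StateTransition.mem_eval.2 ⟨h, hh t⟩)
    (StateTransition.mem_eval.2 ⟨h', hh t'⟩))

/-- Both runs, followed backwards from their common end, agree step by step. Neither can continue
past a start configuration, because the start state is never entered; hence they begin at the same
one. -/
theorem Computes.unique_input (hM : M.IsReversible) {s s' t : List Bool} (h : M.Computes s t)
    (h' : M.Computes s' t) : s = s' := by
  have key : ∀ {c d : M.Cfg}, ReflTransGen (fun a b => b ∈ M.step a) c d → c.state = M.start →
      ∀ c', c'.state = M.start → ReflTransGen (fun a b => b ∈ M.step a) c' d → c = c' := by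
    have hs : ∀ {c d : M.Cfg}, M.step c = some d → d.state ≠ M.start := by
      intro c d h
      obtain ⟨r, hr, rfl⟩ := Option.map_eq_some_iff.1 h
      exact hM.start_not_entered _ _ _ hr
    intro c d h hc c' hc' h'
    induction h with
    | refl =>
      rcases ReflTransGen.cases_tail h' with h | ⟨_, _, h⟩
      · exact h
      · exact absurd hc (hs h)
    | tail _ h ih =>
      rcases ReflTransGen.cases_tail h' with rfl | ⟨b, hb, h₁⟩
      · exact absurd hc' (hs h)
      · obtain rfl := hM.backward_deterministic _ _ _ h h₁
        exact ih hb
  exact stdCfg_injective (key h rfl _ rfl h')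

end TuringMachine

/-! ### Recursively enumerable relations -/

section recursivelyEnumerable

variable {α β γ : Type} [Primcodable α] [Primcodable β] [Primcodable γ]

theorem REPred.comp {p : β → Prop} (hp : REPred p) {f : α → β} (hf : Computable f) :
    REPred fun a => p (f a) :=
  Partrec.comp hp hf

theorem REPred.and {p q : α → Prop} (hp : REPred p) (hq : REPred q) :
    REPred fun a => p a ∧ q a := by
  have hq' : Partrec₂ fun (a : α) (_ : Unit) => Part.assert (q a) fun _ => Part.some () :=
    Partrec.comp hq Computable.fst
  refine (Partrec.bind hp hq').of_eq fun a => Part.ext fun _ => ?_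
  simp [Part.mem_assert_iff]

theorem Computable.eq_re {f g : α → β} (hf : Computable f) (hg : Computable g) :
    REPred fun a => f a = g a := by
  classical
  have h : REPred fun z : β × β => z.1 = z.2 := (PrimrecPred.computablePred Primrec.eq).to_re
  exact h.comp (hf.pair hg)

theorem Partrec.graph_re {f : α →. β} (hf : Partrec f) {g : γ → α} (hg : Computable g)
    {h : γ → β} (hh : Computable h) : REPred fun c => h c ∈ f (g c) := by
  have h₁ : REPred fun z : β × β => z.1 = z.2 := Computable.eq_re .fst .snd
  have h₂ : Partrec₂ fun (c : γ) (b : β) => Part.assert (h c = b) fun _ => Part.some () :=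
    Partrec.comp h₁ ((hh.comp Computable.fst).pair Computable.snd)
  refine (Partrec.dom_re ((hf.comp hg).bind h₂)).of_eq fun c => ?_
  rw [Part.dom_iff_mem]
  simp [Part.mem_assert_iff]

/-- The relation is the graph of a partial function. -/
def IsFunctional {α β : Type} (p : α → β → Prop) : Prop :=
  ∀ ⦃a b b'⦄, p a b → p a b' → b = b'

theorem REPred.exists_partrec {p : α → β → Prop} (hp : REPred fun z : α × β => p z.1 z.2)
    (h : IsFunctional p) : ∃ f : α →. β, Partrec f ∧ ∀ a b, b ∈ f a ↔ p a b := by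
  obtain ⟨f, hf, h₁, h₂⟩ := hp.exists_selector
  refine ⟨f, hf, fun a b => ⟨h₁ a b, fun hb => ?_⟩⟩
  have := Part.get_mem (h₂ a b hb)
  rwa [h (h₁ a _ this) hb] at this

theorem Computable.of_graph_re {f : α → β} (hf : REPred fun z : α × β => z.2 = f z.1) :
    Computable f := by
  obtain ⟨g, hg, h⟩ := REPred.exists_partrec (p := fun a b => b = f a) hf
    fun _ _ _ hb hb' => hb.trans hb'.symm
  exact hg.of_eq fun a => Part.eq_some_iff.2 ((h a _).2 rfl)

end recursivelyEnumerable

/-! ### Codes of strings and numbers -/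

theorem primrec_replicate (b : Bool) : Primrec fun n => List.replicate n b :=
  (Primrec.list_map Primrec.list_range (Primrec.const b).to₂).of_eq fun n => by simp

/-- The string `1^n 0 s`. -/
def unaryPrefix (n : ℕ) (s : List Bool) : List Bool :=
  List.replicate n true ++ false :: s

theorem primrec_unaryPrefix : Primrec₂ unaryPrefix :=
  Primrec.list_append.comp ((primrec_replicate true).comp Primrec.fst)
    (Primrec.list_cons.comp (Primrec.const false) Primrec.snd)

theorem unaryPrefix_inj {n n' : ℕ} {s s' : List Bool} :
    unaryPrefix n s = unaryPrefix n' s' ↔ n = n' ∧ s = s' := by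
  refine ⟨fun h => ?_, fun ⟨h, h'⟩ => h ▸ h' ▸ rfl⟩
  induction n generalizing n' with
  | zero => cases n' <;> simp_all [unaryPrefix, List.replicate_succ]
  | succ n ih =>
    cases n' with
    | zero => simp [unaryPrefix, List.replicate_succ] at h
    | succ n' =>
      have := ih (n' := n') (by simpa [unaryPrefix, List.replicate_succ] using h)
      simpa using this

theorem computable_pair : Computable₂ pair :=
  (primrec_unaryPrefix.comp (Primrec.list_length.comp Primrec.fst)
    (Primrec.list_append.comp Primrec.fst Primrec.snd)).to_comp

/-- A self-delimiting code for a string `r` and a number `b`, followed by `p`. Half of the length of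
the code and of `b` suffices to specify each of them up to its parity. -/
def annotate (r : List Bool) (b : ℕ) (p : List Bool) : List Bool :=
  unaryPrefix (r.length / 2) (unaryPrefix (b / 2)
    (decide (r.length % 2 = 1) :: decide (b % 2 = 1) :: (r ++ p)))

theorem annotate_inj {r r' p p' : List Bool} {b b' : ℕ}
    (h : annotate r b p = annotate r' b' p') : r = r' ∧ b = b' ∧ p = p' := by
  simp only [annotate, unaryPrefix_inj, List.cons.injEq, decide_eq_decide] at h
  obtain ⟨h₁, h₂, h₃, h₄, h₅⟩ := h
  have hr : r.length = r'.length := by omega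
  obtain ⟨h₆, h₇⟩ := List.append_inj h₅ hr
  exact ⟨h₆, by omega, h₇⟩

/-- Each of the two codes spends half of `|r|` and half of `|u|` in unary. In total this is one
extra copy of each length besides `r` and `u` themselves, which yields the factor 2. The 8 counts
two separators and two parity bits per code. -/
theorem length_annotate_add_le (r p u q : List Bool) :
    (annotate r u.length p).length + (annotate u r.length q).length ≤
      p.length + q.length + 2 * (r.length + u.length) + 8 := by
  simp only [annotate, unaryPrefix, List.length_append, List.length_replicate, List.length_cons]
  omega

theorem computable_annotate :
    Computable fun z : List Bool × ℕ × List Bool => annotate z.1 z.2.1 z.2.2 := by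
  have hr : Primrec fun z : List Bool × ℕ × List Bool => z.1.length :=
    Primrec.list_length.comp Primrec.fst
  have hb : Primrec fun z : List Bool × ℕ × List Bool => z.2.1 := Primrec.fst.comp Primrec.snd
  have hd : ∀ {f : List Bool × ℕ × List Bool → ℕ}, Primrec f → Primrec fun z => f z / 2 :=
    fun hf => Primrec.nat_div.comp hf (Primrec.const 2)
  have hm : ∀ {f : List Bool × ℕ × List Bool → ℕ}, Primrec f →
      Primrec fun z => decide (f z % 2 = 1) := fun hf =>
    (Primrec.eq.comp (Primrec.nat_mod.comp hf (Primrec.const 2)) (Primrec.const 1)).decide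
  exact (primrec_unaryPrefix.comp (hd hr) (primrec_unaryPrefix.comp (hd hb)
    (Primrec.list_cons.comp (hm hr) (Primrec.list_cons.comp (hm hb)
      (Primrec.list_append.comp Primrec.fst (Primrec.snd.comp Primrec.snd)))))).to_comp

theorem numOfString_natToString (n : ℕ) : numOfString (natToString n) = n + 1 := by
  have key : ∀ m : ℕ, m ≠ 0 → m.bits.dropLast.foldr (fun b n => n + n + b.toNat) 1 = m := by
    intro m
    induction m using Nat.binaryRec' with
    | zero => exact fun h => absurd rfl h
    | bit b m hm ih =>
      intro _
      rw [Nat.bits_append_bit _ _ hm]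
      rcases eq_or_ne m 0 with rfl | h
      · rw [hm rfl]; rfl
      · have hne : m.bits ≠ [] := fun h' => h (Nat.size_eq_zero.1 (by rw [← Nat.size_eq_bits_len, h']; rfl))
        rw [List.dropLast_cons_of_ne_nil hne, List.foldr_cons, ih h, Nat.bit_val]
        omega
  rw [natToString, numOfString, List.foldl_reverse]
  exact key _ n.succ_ne_zero

theorem natToString_injective : Function.Injective natToString := fun m n h => by
  simpa [numOfString_natToString] using congrArg numOfString h

/-- Its graph is decided by the computable injection `numOfString`, so its values can be found by
search. -/
theorem computable_natToString : Computable natToString := by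
  have h : REPred fun z : ℕ × List Bool => numOfString z.2 = z.1 + 1 :=
    Computable.eq_re (primrec_numOfString.to_comp.comp .snd) (Computable.succ.comp .fst)
  refine Computable.of_graph_re (h.of_eq fun z => ?_)
  rw [← numOfString_natToString, numOfString_injective.eq_iff]

theorem length_natToString_le (n : ℕ) : (natToString n).length ≤ Nat.log 2 (n + 1) := by
  refine Nat.le_log_of_pow_le one_lt_two ?_
  rw [← numOfString_natToString]
  have key : ∀ (s : List Bool) (m : ℕ),
      2 ^ s.length * m ≤ s.foldl (fun n b => n + n + b.toNat) m := by
    intro s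
    induction s with
    | nil => intro m; simp
    | cons b s ih =>
      intro m
      refine le_trans ?_ (ih _)
      rw [List.length_cons, pow_succ, mul_assoc]
      exact Nat.mul_le_mul_left _ (show 2 * m ≤ m + m + b.toNat by omega)
  exact (Nat.mul_one _).symm.trans_le (key (natToString n) 1)

/-! ### Bounds for the Kolmogorov complexity -/

section complexity

variable {U : List Bool →. List Bool}

theorem condC_le {x y p : List Bool} (h : x ∈ U (pair p y)) : condC U x y ≤ p.length :=
  Nat.sInf_le ⟨p, rfl, h⟩

theorem length_pair (x y : List Bool) : (pair x y).length = 2 * x.length + 1 + y.length := by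
  simp only [pair, List.length_append, List.length_replicate, List.length_cons]
  omega

/-- If `x` is recursively enumerably determined by `p` and `y`, then `C(x | y)` is at most the
length of `p`, up to a constant. -/
theorem condC_le_of_rePred (hU : IsUniversalMachine U)
    {r : List Bool × List Bool → List Bool → Prop}
    (hr : REPred fun z : (List Bool × List Bool) × List Bool => r z.1 z.2) (h : IsFunctional r) :
    ∃ c : ℕ, ∀ p y x, r (p, y) x → condC U x y ≤ p.length + c := by
  have hr' : REPred fun z : List Bool × List Bool => ∃ w : List Bool × List Bool,
      z.1 = pair w.1 w.2 ∧ r w z.2 := by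
    refine REPred.exists (p := fun (z w : List Bool × List Bool) =>
      z.1 = pair w.1 w.2 ∧ r w z.2) (REPred.and ?_ ?_)
    · exact Computable.eq_re (Computable.fst.comp .fst) (computable_pair.comp
        (Computable.fst.comp .snd) (Computable.snd.comp .snd))
    · exact hr.comp (Computable.snd.pair (Computable.snd.comp .fst))
  obtain ⟨T, hT, hT'⟩ := REPred.exists_partrec (p := fun s t => ∃ w : List Bool × List Bool,
      s = pair w.1 w.2 ∧ r w t) hr' (by
    rintro s t t' ⟨w, rfl, hw⟩ ⟨w', e, hw'⟩
    rw [Prod.ext (pair_injective e).1 (pair_injective e).2] at hw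
    exact h hw hw')
  obtain ⟨i, hi⟩ := hU.2 T hT
  -- This is the overhead of `⟨i, p⟩` over `p`.
  refine ⟨2 * i.length + 1, fun p y x hx => ?_⟩
  have hm : x ∈ U (pair (pair i p) y) := by
    rw [hi, hT']
    exact ⟨(p, y), rfl, hx⟩
  refine (condC_le hm).trans ?_
  rw [length_pair]
  omega

theorem condC_le_length (hU : IsUniversalMachine U) :
    ∃ c : ℕ, ∀ x y, condC U x y ≤ x.length + c := by
  obtain ⟨c, hc⟩ := condC_le_of_rePred hU (r := fun w x => x = w.1)
    (Computable.eq_re .snd (Computable.fst.comp .fst)) fun _ _ _ h h' => h.trans h'.symm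
  exact ⟨c, fun x y => hc x y x rfl⟩

/-- The lower bound for the irreversibility cost. -/
theorem exists_condC_add_condC_le (hU : IsUniversalMachine U) {R : TuringMachine}
    (hR : R.IsReversible) : ∃ c : ℕ, ∀ x y : List Bool,
      ((condC U y x + condC U x y : ℕ) : ℕ∞) ≤ irrevCost R x y + (c : ℕ∞) := by
  have hw : Computable fun z : (List Bool × List Bool) × List Bool => pair z.1.2 z.1.1 :=
    computable_pair.comp (Computable.snd.comp .fst) (Computable.fst.comp .fst)
  have h₁ : ∃ c : ℕ, ∀ p x y, (∃ q, R.Computes (pair x p) (pair y q)) →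
      condC U y x ≤ p.length + c := by
    refine condC_le_of_rePred hU (r := fun w y => ∃ q, R.Computes (pair w.2 w.1) (pair y q)) ?_ ?_
    · refine REPred.exists (p := fun (z : (List Bool × List Bool) × List Bool) q =>
        R.Computes (pair z.1.2 z.1.1) (pair z.2 q)) ?_
      exact R.rePred_computes.comp (f := fun z : ((List Bool × List Bool) × List Bool) ×
        List Bool => (pair z.1.1.2 z.1.1.1, pair z.1.2 z.2)) ((hw.comp .fst).pair
        (computable_pair.comp (Computable.snd.comp .fst) .snd))
    · rintro w y y' ⟨q, hq⟩ ⟨q', hq'⟩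
      exact (pair_injective (hq.unique hq')).1
  -- Only this half needs reversibility: the output `⟨y, q⟩` determines the input.
  have h₂ : ∃ c : ℕ, ∀ q y x, (∃ p, R.Computes (pair x p) (pair y q)) →
      condC U x y ≤ q.length + c := by
    refine condC_le_of_rePred hU (r := fun w x => ∃ p, R.Computes (pair x p) (pair w.2 w.1)) ?_ ?_
    · refine REPred.exists (p := fun (z : (List Bool × List Bool) × List Bool) p =>
        R.Computes (pair z.2 p) (pair z.1.2 z.1.1)) ?_
      exact R.rePred_computes.comp (f := fun z : ((List Bool × List Bool) × List Bool) ×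
        List Bool => (pair z.1.2 z.2, pair z.1.1.2 z.1.1.1))
        ((computable_pair.comp (Computable.snd.comp .fst) .snd).pair (hw.comp .fst))
    · rintro w y y' ⟨q, hq⟩ ⟨q', hq'⟩
      exact (pair_injective (hq.unique_input hR hq')).1
  obtain ⟨c₁, h₁⟩ := h₁
  obtain ⟨c₂, h₂⟩ := h₂
  refine ⟨c₁ + c₂, fun x y => ?_⟩
  rw [← tsub_le_iff_right]
  refine le_iInf fun p => le_iInf fun q => le_iInf fun h => ?_
  rw [tsub_le_iff_right]
  have := h₁ p x y ⟨q, h⟩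
  have := h₂ q y x ⟨p, h⟩
  exact_mod_cast (by omega : condC U y x + condC U x y ≤ p.length + q.length + (c₁ + c₂))

/-- There is a recursively enumerable choice of a program of each length, for `x` given `y`. -/
theorem exists_canonical_programs (hU : Partrec U) :
    ∃ r : List Bool → List Bool → List Bool → Prop,
      (REPred fun z : List Bool × List Bool × List Bool => r z.1 z.2.1 z.2.2) ∧
      (∀ ⦃p x y⦄, r p x y → x ∈ U (pair p y)) ∧
      (∀ ⦃p p' x y⦄, r p x y → r p' x y → p.length = p'.length → p = p') ∧
      ∀ ⦃p x y⦄, x ∈ U (pair p y) → ∃ p', p'.length = p.length ∧ r p' x y := by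
  have h : REPred fun z : (ℕ × List Bool × List Bool) × List Bool =>
      z.2.length = z.1.1 ∧ z.1.2.1 ∈ U (pair z.2 z.1.2.2) := by
    refine REPred.and (Computable.eq_re (Computable.list_length.comp .snd)
      (Computable.fst.comp .fst)) (hU.graph_re (computable_pair.comp .snd ?_) ?_)
    · exact Computable.snd.comp (Computable.snd.comp .fst)
    · exact Computable.fst.comp (Computable.snd.comp .fst)
  -- The length is part of the argument of the search: minimality of a program cannot be recognised,
  -- but a program of prescribed length can be found if there is one.
  obtain ⟨g, hg, h₁, h₂⟩ := REPred.exists_selector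
    (p := fun (w : ℕ × List Bool × List Bool) p => p.length = w.1 ∧ w.2.1 ∈ U (pair p w.2.2)) h
  refine ⟨fun p x y => p ∈ g (p.length, x, y), ?_, fun p x y hp => (h₁ _ _ hp).2,
    fun p p' x y hp hp' e => ?_, fun p x y hp => ?_⟩
  · exact hg.graph_re ((Computable.list_length.comp .fst).pair .snd) .fst
  · simp only [e] at hp
    exact Part.mem_unique hp hp'
  · have hm := Part.get_mem (h₂ (p.length, x, y) p ⟨rfl, hp⟩)
    have hl := (h₁ _ _ hm).1
    refine ⟨_, hl, ?_⟩
    simpa only [hl] using hm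

/-- The upper bound for the irreversibility cost. -/
theorem exists_irrevCost_le (hU : IsUniversalMachine U) :
    ∃ R : TuringMachine, R.IsReversible ∧ ∀ x y : List Bool,
      irrevCost R x y ≤ ((condC U y x + condC U x y
          + 2 * (condC U (natToString (condC U y x)) y
            + condC U (natToString (condC U x y)) x) + 8 : ℕ) : ℕ∞) := by
  obtain ⟨r, hr, hr₁, hr₂, hr₃⟩ := exists_canonical_programs hU.1
  let half : List Bool × List Bool × List Bool → List Bool × List Bool × List Bool → Prop :=
    fun a b => r a.2.1 b.1 a.1 ∧ r a.2.2 (natToString b.2.1.length) a.1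
  let code : List Bool × List Bool × List Bool → List Bool × List Bool × List Bool → List Bool :=
    fun a b => pair a.1 (annotate a.2.2 b.2.2.length a.2.1)
  let rel : List Bool → List Bool → Prop := fun s t =>
    ∃ w : (List Bool × List Bool × List Bool) × (List Bool × List Bool × List Bool),
      (s = code w.1 w.2 ∧ t = code w.2 w.1) ∧ half w.1 w.2 ∧ half w.2 w.1
  have hsymm : ∀ s t, rel s t → rel t s := fun s t ⟨w, hw, h₁, h₂⟩ => ⟨w.swap, hw.symm, h₂, h₁⟩
  -- Decoding: the input gives `x`, `p`, `v` and `|u|`. Running `p` on `x` gives `y`, and running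
  -- `v` on `x` gives `|q|`. The canonical programs of lengths `|q|` and `|u|`, for `x` and for
  -- `|p|` given `y`, are then `q` and `u`.
  have hfun : IsFunctional rel := by
    rintro s t t' ⟨⟨⟨x, p, v⟩, y, q, u⟩, ⟨rfl, rfl⟩, ⟨hp, hv⟩, hq, hu⟩
      ⟨⟨⟨x', p', v'⟩, y', q', u'⟩, ⟨e, rfl⟩, ⟨hp', hv'⟩, hq', hu'⟩
    simp only at hp hv hq hu hp' hv' hq' hu'
    obtain ⟨rfl, e⟩ := pair_injective e
    obtain ⟨rfl, hl, rfl⟩ := annotate_inj e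
    obtain rfl := Part.mem_unique (hr₁ hp) (hr₁ hp')
    have hq'' := natToString_injective (Part.mem_unique (hr₁ hv) (hr₁ hv'))
    obtain rfl := hr₂ hq hq' hq''
    obtain rfl := hr₂ hu hu' hl
    rfl
  have hcode : ∀ {f g : (List Bool × List Bool) ×
      (List Bool × List Bool × List Bool) × (List Bool × List Bool × List Bool) →
      List Bool × List Bool × List Bool}, Computable f → Computable g →
      Computable fun z => code (f z) (g z) := fun hf hg =>
    computable_pair.comp (Computable.fst.comp hf) (computable_annotate.comp
      ((Computable.snd.comp (Computable.snd.comp hf)).pair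
        ((Computable.list_length.comp (Computable.snd.comp (Computable.snd.comp hg))).pair
          (Computable.fst.comp (Computable.snd.comp hf)))))
  have hhalf : ∀ {f g : (List Bool × List Bool) ×
      (List Bool × List Bool × List Bool) × (List Bool × List Bool × List Bool) →
      List Bool × List Bool × List Bool}, Computable f → Computable g →
      REPred fun z => half (f z) (g z) := fun hf hg =>
    (hr.comp ((Computable.fst.comp (Computable.snd.comp hf)).pair
      ((Computable.fst.comp hg).pair (Computable.fst.comp hf)))).and
    (hr.comp ((Computable.snd.comp (Computable.snd.comp hf)).pair
      ((computable_natToString.comp (Computable.list_length.comp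
        (Computable.fst.comp (Computable.snd.comp hg)))).pair (Computable.fst.comp hf))))
  have hre : REPred fun z : List Bool × List Bool => rel z.1 z.2 := by
    have ha := Computable.fst.comp (Computable.snd (α := List Bool × List Bool)
      (β := (List Bool × List Bool × List Bool) × (List Bool × List Bool × List Bool)))
    have hb := Computable.snd.comp (Computable.snd (α := List Bool × List Bool)
      (β := (List Bool × List Bool × List Bool) × (List Bool × List Bool × List Bool)))
    refine REPred.exists (p := fun (z : List Bool × List Bool) (w : (List Bool × List Bool ×
      List Bool) × (List Bool × List Bool × List Bool)) =>
      (z.1 = code w.1 w.2 ∧ z.2 = code w.2 w.1) ∧ half w.1 w.2 ∧ half w.2 w.1) ?_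
    exact ((Computable.eq_re (Computable.fst.comp .fst) (hcode ha hb)).and
      (Computable.eq_re (Computable.snd.comp .fst) (hcode hb ha))).and
      ((hhalf ha hb).and (hhalf hb ha))
  obtain ⟨f, hf, hf'⟩ := hre.exists_partrec hfun
  obtain ⟨R, hR, hR'⟩ := exists_reversible_of_involution hf fun s t ht =>
    (hf' _ _).2 (hsymm _ _ ((hf' _ _).1 ht))
  refine ⟨R, hR, fun x y => ?_⟩
  have key : ∀ z w : List Bool, ∃ p, p.length = condC U z w ∧ r p z w := by
    intro z w
    obtain ⟨p, hp, hp'⟩ := exists_program_length_eq_condC hU z w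
    obtain ⟨p', hl, h⟩ := hr₃ hp'
    exact ⟨p', hl.trans hp, h⟩
  obtain ⟨p, hp, hp'⟩ := key y x
  obtain ⟨q, hq, hq'⟩ := key x y
  obtain ⟨v, hv, hv'⟩ := key (natToString q.length) x
  obtain ⟨u, hu, hu'⟩ := key (natToString p.length) y
  have h := hR' _ _ ((hf' _ _).2 ⟨((x, p, v), y, q, u), ⟨rfl, rfl⟩, ⟨hp', hv'⟩, hq', hu'⟩)
  refine iInf_le_of_le _ (iInf_le_of_le _ (iInf_le_of_le h (Nat.cast_le.2 ?_)))
  refine (length_annotate_add_le v p u q).trans ?_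
  rw [hv, hu, hp, hq]
  omega

end complexity

theorem mainTheorem3 (U : List Bool →. List Bool) (hU : IsUniversalMachine U)
    (UR : TuringMachine) (hUR : IsUniversalReversible UR) :
    -- the equality up to an additive logarithmic term
    (∃ c : ℕ, ∀ x y : List Bool,
      irrevCost UR x y ≤ ((condC U x y + condC U y x
          + c * Nat.log 2 (condC U x y + condC U y x + 2) : ℕ) : ℕ∞) ∧
      ((condC U x y + condC U y x : ℕ) : ℕ∞) ≤ irrevCost UR x y
          + ((c * Nat.log 2 (condC U x y + condC U y x + 2) : ℕ) : ℕ∞)) ∧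
    -- the upper bound with its explicit error
    (∃ c : ℕ, ∀ x y : List Bool,
      irrevCost UR x y ≤ ((condC U y x + condC U x y
          + 2 * (condC U (natToString (condC U y x)) y
            + condC U (natToString (condC U x y)) x) + c : ℕ) : ℕ∞)) ∧
    -- the lower bound
    (∃ c : ℕ, ∀ x y : List Bool,
      ((condC U y x + condC U x y : ℕ) : ℕ∞) ≤ irrevCost UR x y + (c : ℕ∞)) := by
  obtain ⟨R, hR, hR'⟩ := exists_irrevCost_le hU
  obtain ⟨c, hc⟩ := hUR.2 R hR
  have h₂ : ∀ x y, irrevCost UR x y ≤ ((condC U y x + condC U x y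
      + 2 * (condC U (natToString (condC U y x)) y
        + condC U (natToString (condC U x y)) x) + (8 + c) : ℕ) : ℕ∞) := by
    intro x y
    refine (hc x y).trans ((add_le_add_left (hR' x y) _).trans_eq ?_)
    push_cast
    ring
  obtain ⟨d, h₃⟩ := exists_condC_add_condC_le hU hUR.1
  obtain ⟨k, hk⟩ := condC_le_length hU
  -- With `l` the logarithm, each of the two inner complexities is at most `l + k`, so their doubled
  -- sum is at most `4 * l + 4 * k`. Since `l ≥ 1`, by the `+ 2` inside the logarithm, all constants
  -- are absorbed into multiples of `l`.
  refine ⟨⟨4 + 4 * k + (8 + c) + d, fun x y => ?_⟩, ⟨8 + c, h₂⟩, ⟨d, h₃⟩⟩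
  have hlog : 1 ≤ Nat.log 2 (condC U x y + condC U y x + 2) :=
    Nat.log_pos one_lt_two (by omega)
  have hnat : ∀ n z, n ≤ condC U x y + condC U y x → condC U (natToString n) z ≤
      Nat.log 2 (condC U x y + condC U y x + 2) + k := fun n z hn =>
    (hk _ z).trans (Nat.add_le_add_right ((length_natToString_le n).trans
      (Nat.log_mono_right (by omega))) k)
  generalize hl : Nat.log 2 (condC U x y + condC U y x + 2) = l at *
  have hx := hnat _ x (Nat.le_add_right (condC U x y) (condC U y x))
  have hy := hnat _ y (Nat.le_add_left (condC U y x) (condC U x y))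
  have hkl : k ≤ k * l := Nat.le_mul_of_pos_right _ hlog
  have hcl : 8 + c ≤ (8 + c) * l := Nat.le_mul_of_pos_right _ hlog
  have hdl : d ≤ d * l := Nat.le_mul_of_pos_right _ hlog
  constructor
  · refine (h₂ x y).trans (Nat.cast_le.2 ?_)
    nlinarith
  · rw [add_comm (condC U x y)]
    refine (h₃ x y).trans (add_le_add_right (Nat.cast_le.2 ?_) _)
    nlinarith
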